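/- **Setting.** Let $L\ge 2$. On a probability space let $Y_0,Y_1,V,\Theta$ be real random variables, $Z,\Gamma$ random vectors in $\mathbb{R}^{L-1}$, and $X_0,X_1$ random vectors. Put $$D=\mathbf 1\{V-Z'\Gamma-\Theta>0\},\qquad Y=Y_0+(Y_1-Y_0)D,\qquad X=X_1\text{ if }D=1,\ X=X_0\text{ if }D=0,$$ $$\widetilde S=\frac{(Z',1)'}{\|(Z',1)\|},\qquad \widetilde V=\frac{V}{\|(Z',1)\|},\qquad \widetilde\Gamma=(\Gamma',\Theta)'\in\mathbb{R}^L .$$ The observables are $(Y,D,V,Z,X)$. Let $H^+=\{s\in\mathbb{R}^L:\|s\|=1,\ s_L>0\}$. Densities $f_{A|X}(\cdot|x)$ are those of the conditional law of $A$ given $X=x$, and supports are supports of conditional laws. **Assumption 1.** (i) For almost every $x$, the law of $(\widetilde S,\widetilde V,\widetilde\Gamma)$ given $X=x$ is absolutely continuous with respect to the product of the spherical measure on $\mathbb{S}^{L-1}$ and Lebesgue measure on $\mathbb{R}^{L+1}$. (ii) Conditionally on $X$, $(V,Z)$ is independent of $(Y_0,\Gamma,\Theta)$ and of $(Y_1,\Gamma,\Theta)$.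 (iii) $0<\mathbb{P}(D=1|X)<1$ a.s. (iv) $X_0=X_1$ a.s. **Assumption 2.** For almost every $x$, the support of $\widetilde S$ given $X=x$ is $\overline{H^+}$, and for almost every value $(s,x)$ of $(\widetilde S,X)$ the support of $\widetilde V$ given $\widetilde S=s$, $X=x$ contains every real number in $[\inf_\gamma s'\gamma,\ \sup_\gamma s'\gamma]$, where $\gamma$ ranges over $\mathrm{supp}\,f_{\widetilde\Gamma|X}(\cdot|x)$ and the bounds may be infinite. **Notation.** For $f\in L^1(\mathbb{R}^L)$, $s\in H^+$ and $u\in\mathbb{R}$, let $R[f](s,u)$ be the integral of $f$ over the hyperplane $\{\gamma:s'\gamma=u\}$ with respect to its Lebesgue measure (the Radon transform). For $g$ on $H^+\times\mathbb{R}$, $R^{-1}[g]$ denotes the function $f\in L^1(\mathbb{R}^L)$, unique up to null sets, with $R[f]=g$ a.e. on $H^+\times\mathbb{R}$, if there is one. For an integrable $W$, $\mathbb{E}[W|(\widetilde S,\widetilde V)=\cdot,X=x]$ denotes the version of the regression function that for almost every $x$ is continuous in $(s,v)$ on the support of $(\widetilde S,\widetilde V)$ given $X=x$; $\overline{\partial_v\mathbb{E}[W|(\widetilde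 S,\widetilde V)=\cdot,X=x]}$ is its derivative in $v$ within that support, extended by $0$ outside it. Likewise $\overline{\mathbb{E}[\phi(Y_j)|\widetilde\Gamma=\cdot,X=x]}$ is extended by $0$ outside $\mathrm{supp}\,f_{\widetilde\Gamma|X}(\cdot|x)$. **Theorem.** Under Assumptions 1 and 2, let $\phi$ be a measurable real- or complex-valued function with $\mathbb{E}[|\phi(Y_0)|+|\phi(Y_1)|]<\infty$. Then for $W=D$, $W=\phi(Y)D$ and $W=\phi(Y)(D-1)$ the continuous versions above exist, and for almost every $x$ the zero-extended derivatives below are in the range of $R$ on $L^1(\mathbb{R}^L)$ and, almost everywhere on $\mathbb{R}^L$, $$f_{\widetilde\Gamma|X}(\cdot|x)=R^{-1}\Big[\overline{\partial_v\mathbb{E}[D|(\widetilde S,\widetilde V)=\cdot,X=x]}\Big],$$ $$\overline{\mathbb{E}[\phi(Y_1)|\widetilde\Gamma=\cdot,X=x]}\,f_{\widetilde\Gamma|X}(\cdot|x)=R^{-1}\Big[\overline{\partial_v\mathbb{E}[\phi(Y)D|(\widetilde S,\widetilde V)=\cdot,X=x]}\Big],$$ $$\overline{\mathbb{E}[\phi(Y_0)|\widetilde\Gamma=\cdot,X=x]}\,f_{\widetilde\Gamma|X}(\cdot|x)=R^{-1}\Big[\overline{\partial_v\mathbb{E}[\phi(Y)(D-1)|(\widetilde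 S,\widetilde V)=\cdot,X=x]}\Big].$$ Consequently the three functions on the left are identified: two such models with the same law of $(Y,D,V,Z,X)$, both satisfying the hypotheses, have, for almost every $x$, almost everywhere the same $f_{\widetilde\Gamma|X}(\cdot|x)$ and the same products for $j=0,1$. -/

import Mathlib

open MeasureTheory ProbabilityTheory Set Filter Topology

noncomputable section

/-! ### Geometry and the Radon transform on `ℝ^L`, where `L = n + 1` -/

/-- The space `ℝ^k` with its Euclidean norm. -/
abbrev Eucl (k : ℕ) : Type := EuclideanSpace ℝ (Fin k)

/-- The vector `(z', t)'` of `ℝ^(n+1)`: `t` is appended as the last coordinate. -/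
def appendLast {n : ℕ} (z : Eucl n) (t : ℝ) : Eucl (n + 1) :=
  WithLp.toLp 2 (Fin.snoc (α := fun _ => ℝ) (fun i => z i) t)

/-- The spherical measure on the unit sphere of `ℝ^L`, seen as a measure on `ℝ^L`
(its total mass is the area of the sphere). -/
def sphereMeasure (k : ℕ) : Measure (Eucl k) :=
  ((volume : Measure (Eucl k)).toSphere).map Subtype.val

/-- The half-sphere `H⁺` of unit vectors with positive last coordinate. -/
def halfSphere (n : ℕ) : Set (Eucl (n + 1)) :=
  {s | ‖s‖ = 1 ∧ 0 < s (Fin.last n)}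

/-- The reference measure on `H⁺ × ℝ`: spherical measure times Lebesgue measure. -/
def radonMeasure (n : ℕ) : Measure (Eucl (n + 1) × ℝ) :=
  ((sphereMeasure (n + 1)).restrict (halfSphere n)).prod volume

section Radon

variable {n : ℕ} {F : Type*} [NormedAddCommGroup F] [NormedSpace ℝ F]

/-- The Radon transform: for a unit vector `s`, the integral of `f` over the affine hyperplane
`{γ | ⟪s, γ⟫ = u} = u • s + s^⊥` with respect to its Lebesgue measure. -/
def radon (f : Eucl (n + 1) → F) (p : Eucl (n + 1) × ℝ) : F :=
  ∫ y : (ℝ ∙ p.1)ᗮ, f (p.2 • p.1 + (y : Eucl (n + 1)))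

/-- `g` belongs to the range of the Radon transform on `L¹(ℝ^L)`
(functions on `H⁺ × ℝ` being identified when they agree almost everywhere). -/
def InRadonRange (g : Eucl (n + 1) × ℝ → F) : Prop :=
  ∃ f : Eucl (n + 1) → F, Integrable f ∧ radon f =ᵐ[radonMeasure n] g

open Classical in
/-- The inverse Radon transform: an integrable function whose Radon transform is `g` almost
everywhere on `H⁺ × ℝ` (and `0` if there is none). -/
def radonInv (g : Eucl (n + 1) × ℝ → F) : Eucl (n + 1) → F :=
  if h : InRadonRange g then h.choose else 0

open Classical in
/-- The derivative in `v` of a function `g (s, v)` on a domain `C`, extended by `0`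
outside `C`. -/
def zeroExtDeriv (C : Set (Eucl (n + 1) × ℝ)) (g : Eucl (n + 1) × ℝ → F)
    (p : Eucl (n + 1) × ℝ) : F :=
  if p ∈ C then derivWithin (fun v => g (p.1, v)) {v | (p.1, v) ∈ C} p.2 else 0

end Radon

/-! ### Conditional independence -/

/-- `A` and `B` are independent conditionally on `C`: for almost every `c`, the conditional law of
`(A, B)` given `C = c` is the product of the conditional laws of `A` and of `B`. -/
def CondIndepGiven {Ω α β γ : Type*} [MeasurableSpace Ω]
    [MeasurableSpace α] [StandardBorelSpace α] [Nonempty α]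
    [MeasurableSpace β] [StandardBorelSpace β] [Nonempty β] [MeasurableSpace γ]
    (P : Measure Ω) [IsFiniteMeasure P] (A : Ω → α) (B : Ω → β) (C : Ω → γ) : Prop :=
  ∀ᵐ c ∂(P.map C), condDistrib (fun ω => (A ω, B ω)) C P c
    = (condDistrib A C P c).prod (condDistrib B C P c)

/-! ### The random coefficients selection model -/

/-- The primitives of the model on a probability space `Ω`: potential outcomes `Y₀, Y₁`,
instruments `(V, Z)`, random coefficients `(Γ, Θ)`, and the values `X₀, X₁` that the conditioning
variable takes without and with treatment. -/
structure SelectionModel (n : ℕ) (Ω 𝒳 : Type*) [MeasurableSpace Ω] [MeasurableSpace 𝒳] where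
  P : Measure Ω
  isProb : IsProbabilityMeasure P
  Y₀ : Ω → ℝ
  Y₁ : Ω → ℝ
  V : Ω → ℝ
  Z : Ω → Eucl n
  Γ : Ω → Eucl n
  Θ : Ω → ℝ
  X₀ : Ω → 𝒳
  X₁ : Ω → 𝒳
  measurable_Y₀ : Measurable Y₀
  measurable_Y₁ : Measurable Y₁
  measurable_V : Measurable V
  measurable_Z : Measurable Z
  measurable_Γ : Measurable Γ
  measurable_Θ : Measurable Θ
  measurable_X₀ : Measurable X₀
  measurable_X₁ : Measurable X₁

attribute [instance] SelectionModel.isProb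

namespace SelectionModel

variable {n : ℕ} {Ω 𝒳 : Type*} [MeasurableSpace Ω] [MeasurableSpace 𝒳]
  (M : SelectionModel n Ω 𝒳)

open Classical in
/-- Treatment: `D = 1{V - Z'Γ - Θ > 0}`. -/
def D (ω : Ω) : ℝ := if 0 < M.V ω - inner ℝ (M.Z ω) (M.Γ ω) - M.Θ ω then 1 else 0

/-- Observed outcome: `Y = Y₀ + (Y₁ - Y₀) D`. -/
def Y (ω : Ω) : ℝ := M.Y₀ ω + (M.Y₁ ω - M.Y₀ ω) * M.D ω

open Classical in
/-- Observed conditioning variable: `X₁` for the treated, `X₀` for the untreated. -/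
def X (ω : Ω) : 𝒳 := if M.D ω = 1 then M.X₁ ω else M.X₀ ω

/-- `S̃ = (Z', 1)' / ‖(Z', 1)‖`. -/
def St (ω : Ω) : Eucl (n + 1) := ‖appendLast (M.Z ω) 1‖⁻¹ • appendLast (M.Z ω) 1

/-- `Ṽ = V / ‖(Z', 1)‖`. -/
def Vt (ω : Ω) : ℝ := M.V ω / ‖appendLast (M.Z ω) 1‖

/-- `Γ̃ = (Γ', Θ)'`. -/
def Γt (ω : Ω) : Eucl (n + 1) := appendLast (M.Γ ω) (M.Θ ω)

/-- The law of `X`. -/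
def lawX : Measure 𝒳 := M.P.map M.X

/-- The joint law of the observables `(Y, D, V, Z, X)`. -/
def observedLaw : Measure (ℝ × ℝ × ℝ × Eucl n × 𝒳) :=
  M.P.map fun ω => (M.Y ω, M.D ω, M.V ω, M.Z ω, M.X ω)

/-- The support of the conditional law of `Γ̃` given `X = x`. -/
def suppΓt (x : 𝒳) : Set (Eucl (n + 1)) := (condDistrib M.Γt M.X M.P x).support

/-- The support of the conditional law of `(S̃, Ṽ)` given `X = x`. -/
def suppSV (x : 𝒳) : Set (Eucl (n + 1) × ℝ) :=
  (condDistrib (fun ω => (M.St ω, M.Vt ω)) M.X M.P x).support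

/-- Continuity of instruments and coefficients, instrument independence, overlap, and the
conditioning variable is not caused by the treatment. -/
structure InstrumentAssumption : Prop where
  /-- Given `X = x`, the law of `(S̃, Ṽ, Γ̃)` has a density with respect to the product of the
  spherical measure and Lebesgue measure. -/
  absolutelyContinuous : ∀ᵐ x ∂M.lawX,
    condDistrib (fun ω => (M.St ω, M.Vt ω, M.Γt ω)) M.X M.P x ≪
      (sphereMeasure (n + 1)).prod ((volume : Measure ℝ).prod (volume : Measure (Eucl (n + 1))))
  indep₀ : CondIndepGiven M.P (fun ω => (M.V ω, M.Z ω)) (fun ω => (M.Y₀ ω, M.Γ ω, M.Θ ω)) M.X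
  indep₁ : CondIndepGiven M.P (fun ω => (M.V ω, M.Z ω)) (fun ω => (M.Y₁ ω, M.Γ ω, M.Θ ω)) M.X
  /-- `0 < ℙ(D = 1 | X) < 1` almost surely. -/
  overlap : ∀ᵐ x ∂M.lawX,
    0 < condDistrib M.D M.X M.P x {1} ∧ condDistrib M.D M.X M.P x {1} < 1
  notCaused : M.X₀ =ᵐ[M.P] M.X₁

/-- Large support: given `X = x`, the support of `S̃` is the closed half-sphere, and given
`S̃ = s, X = x`, the support of `Ṽ` contains all the real numbers between the infimum and the
supremum (possibly infinite) of `⟪s, γ⟫` over `γ` in the support of `Γ̃` given `X = x`. -/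
structure LargeSupport : Prop where
  support_St : ∀ᵐ x ∂M.lawX, (condDistrib M.St M.X M.P x).support = closure (halfSphere n)
  support_Vt : ∀ᵐ p ∂(M.P.map fun ω => (M.St ω, M.X ω)),
    {u : ℝ | (⨅ γ ∈ M.suppΓt p.2, ((inner ℝ p.1 γ : ℝ) : EReal)) ≤ (u : EReal) ∧
      (u : EReal) ≤ ⨆ γ ∈ M.suppΓt p.2, ((inner ℝ p.1 γ : ℝ) : EReal)} ⊆
    (condDistrib M.Vt (fun ω => (M.St ω, M.X ω)) M.P p).support

/-- The conditional density `f_{Γ̃|X}(γ | x)`. -/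
def condDensity (x : 𝒳) (γ : Eucl (n + 1)) : ℝ :=
  ((condDistrib M.Γt M.X M.P x).rnDeriv volume γ).toReal

section Regression

variable {F : Type*} [NormedAddCommGroup F] [NormedSpace ℝ F]

/-- The product of `E[φ(U) | Γ̃ = γ, X = x]`, extended by `0` outside the support of `Γ̃` given
`X = x`, and of the conditional density `f_{Γ̃|X}(γ | x)`. Here `U` is a real random variable. -/
def condMeanDensity (U : Ω → ℝ) (φ : ℝ → F) (x : 𝒳) (γ : Eucl (n + 1)) : F :=
  M.condDensity x γ • (M.suppΓt x).indicator
    (fun γ' => ∫ y, φ y ∂(condDistrib U (fun ω => (M.Γt ω, M.X ω)) M.P (γ', x))) γ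

variable [CompleteSpace F]

/-- `m (s, v, x)` is a version of the regression function `E[W | S̃ = s, Ṽ = v, X = x]` which, for
almost every `x`, is continuous in `(s, v)` on the support of `(S̃, Ṽ)` given `X = x`. Such a version
is unique there, for almost every `x`. -/
structure IsRegression (W : Ω → F) (m : Eucl (n + 1) × ℝ × 𝒳 → F) : Prop where
  stronglyMeasurable : StronglyMeasurable m
  condExp_eq : (fun ω => m (M.St ω, M.Vt ω, M.X ω)) =ᵐ[M.P]
    M.P[W | MeasurableSpace.comap (fun ω => (M.St ω, M.Vt ω, M.X ω)) inferInstance]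
  continuousOn : ∀ᵐ x ∂M.lawX, ContinuousOn (fun p => m (p.1, p.2, x)) (M.suppSV x)

/-- `T x = R⁻¹[ zero-extended ∂_v E[W | (S̃, Ṽ) = ·, X = x] ]` for almost every `x`, almost everywhere.
This includes that the regression function exists and that the zero-extended
derivative is in the range of the Radon transform. -/
def EqRadonInvDeriv (W : Ω → F) (T : 𝒳 → Eucl (n + 1) → F) : Prop :=
  (∃ m, M.IsRegression W m) ∧
  ∀ m, M.IsRegression W m → ∀ᵐ x ∂M.lawX,
    InRadonRange (zeroExtDeriv (M.suppSV x) fun p => m (p.1, p.2, x)) ∧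
    T x =ᵐ[volume] radonInv (zeroExtDeriv (M.suppSV x) fun p => m (p.1, p.2, x))

end Regression

end SelectionModel

end

/-!
The proof works at a fixed value `x` of `X`. Dividing the selection equation by `‖(Z', 1)‖` turns it
into `D = 1{⟪S̃, Γ̃⟫ < Ṽ}`. As the instruments are independent of `(Y_j, Γ̃)` given `X`, the regression
function of `φ(Y) D` is an integral over a half-space,
`E[φ(Y) D | S̃ = s, Ṽ = v, X = x] = ∫_{⟪s, γ⟫ < v} f γ dγ`, `f = E[φ(Y₁) | Γ̃ = ·, X = x] f_{Γ̃|X}(· | x)`,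
and the one of `φ(Y) (D - 1)` is the same expression with `Y₀`, minus a constant
(`SelectionModel.ae_regressionVersion_eq`, `SelectionModel.isRegression_regressionVersion`).
By Fubini, the integral over a half-space is the primitive in `v` of the Radon transform of `f`, so its
derivative is `R[f]` almost everywhere (`ae_hasDerivAt_radon`).

The derivative is only observed on the support `C` of `(S̃, Ṽ)`. Large support shows that the slice of
`C` at `s` contains the interior of the range of `⟪s, γ⟫` over the support of `Γ̃`. The assumption gives
this for almost every `s` in the sense of the law of `S̃`, which may vanish on sets of positive
spherical measure; since these `s` are dense in the half-sphere and `C` is closed, it holds for every `s`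
(`mem_of_mem_slices_dense`). Elsewhere, the integral over the half-space is constant on one side of `v`,
so that its derivative vanishes like the extension by zero (`zeroExtDeriv_eq_of_hasDerivAt`). Thus the
zero-extended derivative is `R[f]` almost everywhere.

The inversion formula follows from the injectivity of `R` on `L¹`
(`ae_eq_zero_of_radon_ae_eq_zero`): if `R[f] = 0`, then `f` is orthogonal to all plane waves
`cos (2π⟪ξ, ·⟫)` and `sin (2π⟪ξ, ·⟫)`, hence to all test functions by Fourier inversion. For
identification, note that the right-hand sides only depend on the law of the observables, because
conditional laws only depend on joint laws (`SelectionModel.EqRadonInvDeriv.identified`).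
-/

/-! ### Integration over parallel hyperplanes -/

section Slicing

variable {n : ℕ} {F : Type*} [NormedAddCommGroup F] [NormedSpace ℝ F]

lemma measurePreserving_hyperplane (s : Eucl (n + 1)) (hs : ‖s‖ = 1) :
    MeasurePreserving
      (fun p : ℝ × (ℝ ∙ s)ᗮ => p.1 • s + (p.2 : Eucl (n + 1))) := by
  have h1 : MeasurePreserving (fun p : ℝ × (ℝ ∙ s)ᗮ =>
      ((LinearIsometryEquiv.toSpanUnitSingleton (𝕜 := ℝ) s hs p.1, p.2) : (ℝ ∙ s) × (ℝ ∙ s)ᗮ)) :=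
    (LinearIsometryEquiv.toSpanUnitSingleton (𝕜 := ℝ) s hs).measurePreserving.prod
      (MeasurePreserving.id volume)
  have h2 := ((ℝ ∙ s).orthogonalDecomposition.symm.measurePreserving.comp
    (WithLp.volume_preserving_toLp _ _)).comp h1
  convert! h2 using 2 with p

lemma measurableEmbedding_hyperplane (s : Eucl (n + 1)) (hs : ‖s‖ = 1) :
    MeasurableEmbedding
      (fun p : ℝ × (ℝ ∙ s)ᗮ => p.1 • s + (p.2 : Eucl (n + 1))) := by
  refine (measurePreserving_hyperplane s hs).measurable.measurableEmbedding ?_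
  rintro ⟨u, y⟩ ⟨u', y'⟩ h
  have hy : ∀ y : (ℝ ∙ s)ᗮ, inner ℝ s (y : Eucl (n + 1)) = 0 := fun y =>
    Submodule.mem_orthogonal_singleton_iff_inner_right.1 y.2
  have h' := congrArg (fun z => inner ℝ s z) h
  simp only [inner_add_right, inner_smul_right, hy, real_inner_self_eq_norm_sq, hs] at h'
  have hu : u = u' := by simpa using h'
  subst hu
  simpa using h

lemma inner_hyperplane (s : Eucl (n + 1)) (hs : ‖s‖ = 1) (u : ℝ) (y : (ℝ ∙ s)ᗮ) :
    inner ℝ s (u • s + (y : Eucl (n + 1))) = u := by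
  have hy : inner ℝ s (y : Eucl (n + 1)) = 0 :=
    Submodule.mem_orthogonal_singleton_iff_inner_right.1 y.2
  simp [inner_add_right, inner_smul_right, hy, hs]

lemma integrable_hyperplane {G : Type*} [NormedAddCommGroup G] {f : Eucl (n + 1) → G}
    (hf : Integrable f) (s : Eucl (n + 1)) (hs : ‖s‖ = 1) :
    Integrable (fun p : ℝ × (ℝ ∙ s)ᗮ => f (p.1 • s + (p.2 : Eucl (n + 1))))
      (volume.prod volume) :=
  ((measurePreserving_hyperplane s hs).integrable_comp_emb
    (measurableEmbedding_hyperplane s hs)).2 hf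

/-- For each direction `s`, the Radon transform of an integrable function is integrable in `u`. -/
lemma integrable_radon {f : Eucl (n + 1) → F} (hf : Integrable f)
    (s : Eucl (n + 1)) (hs : ‖s‖ = 1) : Integrable (fun u => radon f (s, u)) :=
  (integrable_hyperplane hf s hs).integral_prod_left

/-- Fubini along the direction `s`: integrating `f` against a function of `⟪s, γ⟫` only involves the
Radon transform of `f` at `s`. -/
lemma integral_inner_smul {f : Eucl (n + 1) → F} (s : Eucl (n + 1)) (hs : ‖s‖ = 1)
    (h : ℝ → ℝ) (hf : Integrable (fun γ => h (inner ℝ s γ) • f γ)) :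
    ∫ γ, h (inner ℝ s γ) • f γ = ∫ u, h u • radon f (s, u) := by
  rw [← (measurePreserving_hyperplane s hs).integral_comp (measurableEmbedding_hyperplane s hs),
    Measure.volume_eq_prod, integral_prod _ (integrable_hyperplane hf s hs)]
  simp only [inner_hyperplane s hs, radon, integral_smul]

lemma radon_sub_ae {f g : Eucl (n + 1) → F} (hf : Integrable f) (hg : Integrable g)
    (s : Eucl (n + 1)) (hs : ‖s‖ = 1) :
    ∀ᵐ u, radon (f - g) (s, u) = radon f (s, u) - radon g (s, u) := by
  filter_upwards [(integrable_hyperplane hf s hs).prod_right_ae,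
    (integrable_hyperplane hg s hs).prod_right_ae] with u h1 h2
  exact integral_sub h1 h2

end Slicing

/-! ### Joint measurability of the Radon transform -/

section Measurability

variable {n : ℕ} {F : Type*} [NormedAddCommGroup F] [NormedSpace ℝ F]

lemma integral_submodule_comp_isometry {K K' : Submodule ℝ (Eucl (n + 1))}
    (ρ : Eucl (n + 1) ≃ₗᵢ[ℝ] Eucl (n + 1))
    (h : K.map (ρ.toLinearEquiv : Eucl (n + 1) →ₗ[ℝ] _) = K')
    (f : Eucl (n + 1) → F) : ∫ y : K', f y = ∫ y : K, f (ρ y) := by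
  subst h
  have := (ρ.submoduleMap K).measurePreserving.integral_comp
    (ρ.submoduleMap K).toHomeomorph.measurableEmbedding
    (fun y => f (y : Eucl (n + 1)))
  exact this.symm

/-- The reflection that exchanges the unit vectors `e` and `s` maps `e^⊥` onto `s^⊥`. -/
lemma map_reflection_orthogonal (e s : Eucl (n + 1)) (he : ‖e‖ = 1) (hs : ‖s‖ = 1) :
    (ℝ ∙ e)ᗮ.map (((ℝ ∙ (e - s))ᗮ.reflection).toLinearEquiv : Eucl (n + 1) →ₗ[ℝ] _)
      = (ℝ ∙ s)ᗮ := by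
  set ρ := (ℝ ∙ (e - s))ᗮ.reflection
  have hρ : ρ e = s := Submodule.reflection_sub (by rw [he, hs])
  have hρ' : ρ s = e := by
    rw [← hρ]; exact Submodule.reflection_reflection _ _
  ext y
  simp only [Submodule.mem_map, Submodule.mem_orthogonal_singleton_iff_inner_right]
  constructor
  · rintro ⟨z, hz, rfl⟩
    change inner ℝ s (ρ z) = 0
    rw [← hρ, ρ.inner_map_map, hz]
  · intro hy
    refine ⟨ρ y, ?_, Submodule.reflection_reflection _ _⟩
    rw [← hρ', ρ.inner_map_map, hy]

/-- The Radon transform as an integral over the fixed hyperplane `e^⊥`. At `s = e` the convention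
`0 / 0 = 0` makes the reflection the identity, so the formula needs no exception. -/
lemma radon_eq_integral_reflection (f : Eucl (n + 1) → F) (e s : Eucl (n + 1))
    (he : ‖e‖ = 1) (hs : ‖s‖ = 1) (u : ℝ) :
    radon f (s, u) = ∫ y : (ℝ ∙ e)ᗮ, f (u • s + ((y : Eucl (n + 1)) -
      (2 * (inner ℝ (e - s) (y : Eucl (n + 1)) / ‖e - s‖ ^ 2)) • (e - s))) := by
  have := integral_submodule_comp_isometry (K := (ℝ ∙ e)ᗮ) (K' := (ℝ ∙ s)ᗮ)
    ((ℝ ∙ (e - s))ᗮ.reflection) (map_reflection_orthogonal e s he hs)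
    (fun y => f (u • s + y))
  rw [radon, this]
  congr 1 with y
  rw [Submodule.reflection_orthogonal_apply, Submodule.reflection_singleton_apply]
  congr 2
  simp [two_mul, add_smul, two_smul]

/-- On unit directions, the Radon transform of a strongly measurable function coincides with a
jointly measurable function: after the reflection, the domain of integration is independent of the
direction. -/
lemma exists_stronglyMeasurable_eq_radon {f : Eucl (n + 1) → F} (hf : StronglyMeasurable f) :
    ∃ g : Eucl (n + 1) × ℝ → F, StronglyMeasurable g ∧
      ∀ s, ‖s‖ = 1 → ∀ u, radon f (s, u) = g (s, u) := by
  obtain ⟨e, he⟩ : ∃ e : Eucl (n + 1), ‖e‖ = 1 := exists_norm_eq _ zero_le_one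
  refine ⟨fun p => ∫ y : (ℝ ∙ e)ᗮ, f (p.2 • p.1 + ((y : Eucl (n + 1)) -
      (2 * (inner ℝ (e - p.1) (y : Eucl (n + 1)) / ‖e - p.1‖ ^ 2)) • (e - p.1))), ?_,
    fun s hs u => radon_eq_integral_reflection f e s he hs u⟩
  have : Measurable (fun q : (Eucl (n + 1) × ℝ) × (ℝ ∙ e)ᗮ =>
      q.1.2 • q.1.1 + ((q.2 : Eucl (n + 1)) -
      (2 * (inner ℝ (e - q.1.1) (q.2 : Eucl (n + 1)) / ‖e - q.1.1‖ ^ 2)) • (e - q.1.1))) := by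
    fun_prop
  exact (hf.comp_measurable this).integral_prod_right'

end Measurability

/-! ### Integrals over half-spaces and their derivative -/

section Cumulative

variable {n : ℕ} {F : Type*} [NormedAddCommGroup F] [NormedSpace ℝ F]

/-- The integral of `f` over the open half-space `{γ | ⟪s, γ⟫ < v}`. -/
noncomputable def halfSpaceIntegral (f : Eucl (n + 1) → F) (s : Eucl (n + 1)) (v : ℝ) : F :=
  ∫ γ in {γ | inner ℝ s γ < v}, f γ

lemma measurableSet_halfSpace (s : Eucl (n + 1)) (v : ℝ) :
    MeasurableSet {γ : Eucl (n + 1) | inner ℝ s γ < v} :=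
  measurableSet_lt (by fun_prop) (by fun_prop)

lemma ae_inner_ne (s : Eucl (n + 1)) (hs : s ≠ 0) (v : ℝ) :
    ∀ᵐ γ : Eucl (n + 1), inner ℝ s γ ≠ v := by
  let A : AffineSubspace ℝ (Eucl (n + 1)) :=
    (AffineSubspace.mk' v (⊥ : Submodule ℝ ℝ)).comap (innerₛₗ ℝ s).toAffineMap
  have hA : (A : Set (Eucl (n + 1))) = {γ | inner ℝ s γ = v} := by
    ext γ
    simp [A, AffineSubspace.mem_mk', sub_eq_zero]
  have hA' : A ≠ ⊤ := by
    intro h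
    have h1 : ∀ γ, γ ∈ (A : Set (Eucl (n + 1))) := by intro γ; rw [h]; trivial
    rw [hA] at h1
    have h2 := h1 0
    have h3 := h1 s
    simp only [mem_ofPred_eq, inner_zero_right] at h2 h3
    rw [← h2] at h3
    exact hs (inner_self_eq_zero.1 h3)
  have := Measure.addHaar_affineSubspace (volume : Measure (Eucl (n + 1))) A hA'
  rw [hA] at this
  exact measure_eq_zero_iff_ae_notMem.1 this

lemma halfSpaceIntegral_eq_integral (f : Eucl (n + 1) → F) (s : Eucl (n + 1)) (v : ℝ) :
    halfSpaceIntegral f s v = ∫ γ, (Iio v).indicator (fun _ => (1 : ℝ)) (inner ℝ s γ) • f γ := by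
  rw [halfSpaceIntegral, ← integral_indicator (measurableSet_halfSpace s v)]
  congr 1 with γ
  by_cases h : inner ℝ s γ < v <;> simp [indicator, h]

lemma continuousAt_halfSpaceIntegral {f : Eucl (n + 1) → F} (hf : Integrable f)
    {p : Eucl (n + 1) × ℝ} (hp : p.1 ≠ 0) :
    ContinuousAt (fun p : Eucl (n + 1) × ℝ => halfSpaceIntegral f p.1 p.2) p := by
  simp_rw [halfSpaceIntegral, ← integral_indicator (measurableSet_halfSpace _ _)]
  refine continuousAt_of_dominated (bound := fun γ => ‖f γ‖) ?_ ?_ hf.norm ?_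
  · exact Eventually.of_forall fun q =>
      (hf.indicator (measurableSet_halfSpace _ _)).aestronglyMeasurable
  · exact Eventually.of_forall fun q => Eventually.of_forall fun γ => norm_indicator_le_norm_self _ _
  · filter_upwards [ae_inner_ne p.1 hp p.2] with γ hγ
    have hc : Continuous fun q : Eucl (n + 1) × ℝ => inner ℝ q.1 γ - q.2 := by fun_prop
    refine (continuousAt_const (y := ({γ | inner ℝ p.1 γ < p.2} : Set _).indicator f γ)).congr ?_
    rcases lt_or_gt_of_ne hγ with h | h
    · filter_upwards [hc.continuousAt.eventually_lt (continuousAt_const (y := (0 : ℝ)))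
        (sub_neg.2 h)] with q hq
      simp [indicator, h, sub_neg.1 hq]
    · filter_upwards [(continuousAt_const (y := (0 : ℝ))).eventually_lt hc.continuousAt
        (sub_pos.2 h)] with q hq
      simp [indicator, not_lt.2 h.le, not_lt.2 (sub_pos.1 hq).le]

lemma halfSpaceIntegral_eq_setIntegral_radon {f : Eucl (n + 1) → F} (hf : Integrable f)
    (s : Eucl (n + 1)) (hs : ‖s‖ = 1) (v : ℝ) :
    halfSpaceIntegral f s v = ∫ u in Iic v, radon f (s, u) := by
  rw [halfSpaceIntegral_eq_integral, integral_inner_smul s hs, integral_Iic_eq_integral_Iio,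
    ← integral_indicator measurableSet_Iio]
  · congr 1 with u
    by_cases h : u < v <;> simp [indicator, h]
  · have := hf.indicator (measurableSet_halfSpace s v)
    refine this.congr (Eventually.of_forall fun γ => ?_)
    by_cases h : inner ℝ s γ < v <;> simp [indicator, h]

variable [CompleteSpace F]

lemma ae_hasDerivAt_halfSpaceIntegral {f : Eucl (n + 1) → F} (hf : Integrable f)
    (s : Eucl (n + 1)) (hs : ‖s‖ = 1) :
    ∀ᵐ v, HasDerivAt (halfSpaceIntegral f s) (radon f (s, v)) v := by
  have hi := integrable_radon hf s hs
  filter_upwards [LocallyIntegrable.ae_hasDerivAt_integral hi.locallyIntegrable] with v hv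
  have h := (hv 0).const_add (∫ u in Iic 0, radon f (s, u))
  refine h.congr_of_eventuallyEq (Eventually.of_forall fun w => ?_)
  have hw := intervalIntegral.integral_Iic_sub_Iic (a := 0) (b := w) hi.integrableOn hi.integrableOn
  change _ = _ + _
  rw [halfSpaceIntegral_eq_setIntegral_radon hf s hs, ← hw, add_sub_cancel]

lemma isOpen_pos_last : IsOpen {s : Eucl (n + 1) | 0 < s (Fin.last n)} :=
  isOpen_lt continuous_const (by fun_prop)

lemma measurableSet_halfSphere : MeasurableSet (halfSphere n) :=
  (measurableSet_eq_fun (by fun_prop) measurable_const).inter isOpen_pos_last.measurableSet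

/-- By Lebesgue differentiation, `R[f]` is the derivative in `v` of the mass of the half-spaces. -/
lemma ae_hasDerivAt_radon {f : Eucl (n + 1) → F} (hf : Integrable f) (hfm : StronglyMeasurable f) :
    ∀ᵐ p ∂radonMeasure n, HasDerivAt (halfSpaceIntegral f p.1) (radon f p) p.2 := by
  obtain ⟨g, hg, hgf⟩ := exists_stronglyMeasurable_eq_radon hfm
  have hcont : Continuous (Function.uncurry
      (fun (s : halfSphere n) (v : ℝ) => halfSpaceIntegral f (s : Eucl (n + 1)) v)) := by
    rw [continuous_iff_continuousAt]
    rintro ⟨s, v⟩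
    have hs : (s : Eucl (n + 1)) ≠ 0 := by
      intro h; have := s.2.1; rw [h] at this; simp at this
    have hval : Continuous fun q : halfSphere n × ℝ => ((q.1 : Eucl (n + 1)), q.2) :=
      (continuous_subtype_val.comp continuous_fst).prodMk continuous_snd
    exact ContinuousAt.comp (f := fun q : halfSphere n × ℝ => ((q.1 : Eucl (n + 1)), q.2))
      (x := (s, v)) (continuousAt_halfSpaceIntegral hf (p := ((s : Eucl (n + 1)), v)) hs)
      hval.continuousAt
  -- measurability is needed to pass from every direction to almost every pair
  have hA : MeasurableSet {p : halfSphere n × ℝ |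
      DifferentiableAt ℝ (halfSpaceIntegral f (p.1 : Eucl (n + 1))) p.2 ∧
      deriv (halfSpaceIntegral f (p.1 : Eucl (n + 1))) p.2 = g (p.1, p.2)} := by
    refine (measurableSet_of_differentiableAt_with_param ℝ hcont).inter ?_
    exact StronglyMeasurable.measurableSet_eq_fun (stronglyMeasurable_deriv_with_param hcont)
      (hg.comp_measurable (by fun_prop))
  have he : MeasurableEmbedding (Prod.map (Subtype.val : halfSphere n → _) (id : ℝ → ℝ)) :=
    (MeasurableEmbedding.subtype_coe measurableSet_halfSphere).prodMap MeasurableEmbedding.id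
  have hA' := he.measurableSet_image.2 hA
  set B := Prod.map (Subtype.val : halfSphere n → _) (id : ℝ → ℝ) '' _ with hB
  have hmem : ∀ p ∈ B, HasDerivAt (halfSpaceIntegral f p.1) (radon f p) p.2 := by
    rintro _ ⟨⟨s, v⟩, ⟨h1, h2⟩, rfl⟩
    have := h1.hasDerivAt
    rw [h2, ← hgf _ s.2.1] at this
    exact this
  suffices h : ∀ᵐ p ∂radonMeasure n, p ∈ B from h.mono hmem
  rw [radonMeasure]
  refine (Measure.ae_prod_iff_ae_ae (p := fun p => p ∈ B) hA').2 ?_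
  refine (ae_restrict_iff' measurableSet_halfSphere).2 (Eventually.of_forall fun s hs => ?_)
  filter_upwards [ae_hasDerivAt_halfSpaceIntegral hf s hs.1] with v hv
  exact ⟨(⟨s, hs⟩, v), ⟨hv.differentiableAt, by rw [← hgf _ hs.1]; exact hv.deriv⟩, rfl⟩

end Cumulative

/-! ### Injectivity of the Radon transform -/

section Injectivity

open scoped FourierTransform

variable {n : ℕ} {F : Type*} [NormedAddCommGroup F] [NormedSpace ℝ F]

lemma ae_ae_of_ae_radonMeasure {p : Eucl (n + 1) × ℝ → Prop} (h : ∀ᵐ q ∂radonMeasure n, p q) :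
    ∀ᵐ s : Metric.sphere (0 : Eucl (n + 1)) 1 ∂(volume : Measure (Eucl (n + 1))).toSphere,
      (s : Eucl (n + 1)) ∈ halfSphere n → ∀ᵐ u, p (s, u) := by
  have h1 := (ae_restrict_iff' measurableSet_halfSphere).1 (Measure.ae_ae_of_ae_prod h)
  exact ae_of_ae_map measurable_subtype_coe.aemeasurable h1

/-- An integrable function whose Radon transform vanishes almost everywhere is orthogonal to almost
every bounded continuous plane wave: the integral over `γ` of a function of `⟪s, γ⟫` only involves
the Radon transform in the direction `s`, and almost every `ξ` is a multiple of a vector of the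
half-sphere. -/
lemma ae_integral_wave_eq_zero {f : Eucl (n + 1) → F} (hf : Integrable f)
    (h : ∀ᵐ s : Metric.sphere (0 : Eucl (n + 1)) 1 ∂(volume : Measure (Eucl (n + 1))).toSphere,
      (s : Eucl (n + 1)) ∈ halfSphere n → ∀ᵐ u, radon f (s, u) = 0)
    {c : ℝ → ℝ} (hc : Continuous c) {B : ℝ} (hB : ∀ u, ‖c u‖ ≤ B) :
    ∀ᵐ ξ : Eucl (n + 1), ∫ γ, c (inner ℝ ξ γ) • f γ = 0 := by
  have hint : ∀ ξ : Eucl (n + 1), Integrable (fun γ => c (inner ℝ ξ γ) • f γ) := fun ξ =>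
    hf.bdd_smul B (by fun_prop) (Eventually.of_forall fun γ => hB _)
  have hcont : Continuous fun ξ : Eucl (n + 1) => ∫ γ, c (inner ℝ ξ γ) • f γ := by
    refine continuous_of_dominated (bound := fun γ => B * ‖f γ‖) (fun ξ => (hint ξ).1) ?_
      (hf.norm.const_mul B) (Eventually.of_forall fun γ => by fun_prop)
    refine fun ξ => Eventually.of_forall fun γ => ?_
    rw [norm_smul]
    exact mul_le_mul_of_nonneg_right (hB _) (norm_nonneg _)
  -- along almost every direction of the half-sphere, hence along every one by continuity
  have hdir : ∀ s ∈ halfSphere n, ∀ t : ℝ, ∫ γ, c (inner ℝ (t • s) γ) • f γ = 0 := by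
    intro s hs t
    have hopen : IsOpen {s : Metric.sphere (0 : Eucl (n + 1)) 1 |
        0 < (s : Eucl (n + 1)) (Fin.last n) ∧
          ∫ γ, c (inner ℝ (t • (s : Eucl (n + 1))) γ) • f γ ≠ 0} := by
      refine (isOpen_pos_last.preimage continuous_subtype_val).inter
        (isOpen_ne.preimage (hcont.comp ?_))
      exact continuous_subtype_val.const_smul t
    have hnull : (volume : Measure (Eucl (n + 1))).toSphere
        {s : Metric.sphere (0 : Eucl (n + 1)) 1 | 0 < (s : Eucl (n + 1)) (Fin.last n) ∧
          ∫ γ, c (inner ℝ (t • (s : Eucl (n + 1))) γ) • f γ ≠ 0} = 0 := by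
      rw [measure_eq_zero_iff_ae_notMem]
      filter_upwards [h] with s hs
      rintro ⟨hs1, hs2⟩
      have hs0 : ‖(s : Eucl (n + 1))‖ = 1 := by simp
      apply hs2
      simp only [inner_smul_left, conj_trivial]
      rw [integral_inner_smul (s : Eucl (n + 1)) hs0 (fun u => c (t * u))]
      · refine integral_eq_zero_of_ae ?_
        filter_upwards [hs ⟨hs0, hs1⟩] with u hu
        simp [hu]
      · simpa only [inner_smul_left, conj_trivial] using hint (t • (s : Eucl (n + 1)))
    rw [IsOpen.measure_eq_zero_iff (volume : Measure (Eucl (n + 1))).toSphere hopen] at hnull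
    by_contra hne
    have : (⟨s, by simpa using hs.1⟩ : Metric.sphere (0 : Eucl (n + 1)) 1) ∈
        (∅ : Set (Metric.sphere (0 : Eucl (n + 1)) 1)) := by
      rw [← hnull]; exact ⟨hs.2, hne⟩
    exact this
  filter_upwards [ae_inner_ne (EuclideanSpace.single (Fin.last n) (1 : ℝ))
    (by simp) 0] with ξ hξ
  rw [EuclideanSpace.inner_single_left] at hξ
  simp only [map_one, one_mul] at hξ
  have hξ0 : ‖ξ‖ ≠ 0 := by
    rw [norm_ne_zero_iff]; rintro rfl; simp at hξ
  rcases lt_or_gt_of_ne hξ with hlt | hgt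
  · have := hdir (-‖ξ‖⁻¹ • ξ) ⟨by simp [norm_smul, hξ0], by
      simpa using mul_pos_of_neg_of_neg (neg_neg_of_pos (by positivity : 0 < ‖ξ‖⁻¹)) hlt⟩ (-‖ξ‖)
    simpa [smul_smul, hξ0] using this
  · have := hdir (‖ξ‖⁻¹ • ξ) ⟨by simp [norm_smul, hξ0], by
      simpa using mul_pos (by positivity : 0 < ‖ξ‖⁻¹) hgt⟩ ‖ξ‖
    simpa [smul_smul, hξ0] using this

/-- A real test function is a superposition of cosines and sines with integrable amplitudes. -/
lemma exists_cos_sin_representation {g : Eucl (n + 1) → ℝ} (hg : ContDiff ℝ (↑(⊤ : ℕ∞)) g)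
    (hgc : HasCompactSupport g) :
    ∃ a b : Eucl (n + 1) → ℝ, Integrable a ∧ Integrable b ∧ ∀ γ,
      g γ = (∫ ξ, Real.cos (2 * Real.pi * inner ℝ ξ γ) * a ξ)
        - ∫ ξ, Real.sin (2 * Real.pi * inner ℝ ξ γ) * b ξ := by
  have hG : ContDiff ℝ (↑(⊤ : ℕ∞)) (fun γ => (g γ : ℂ)) := Complex.ofRealCLM.contDiff.comp hg
  have hGc : HasCompactSupport (fun γ => (g γ : ℂ)) := hgc.comp_left (g := ((↑) : ℝ → ℂ)) (by simp)
  let S := hGc.toSchwartzMap hG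
  have hS : ⇑S = fun γ => (g γ : ℂ) := rfl
  have hint : Integrable (𝓕 (fun γ => (g γ : ℂ))) := by
    rw [← hS, ← SchwartzMap.fourier_coe]; exact SchwartzMap.integrable _
  have hinv := hG.continuous.fourierInv_fourier_eq (by rw [← hS]; exact SchwartzMap.integrable _)
    hint
  generalize 𝓕 (fun γ => (g γ : ℂ)) = A at hint hinv
  have ha : Integrable fun ξ => (A ξ).re := hint.re
  have hb : Integrable fun ξ => (A ξ).im := hint.im
  refine ⟨_, _, ha, hb, fun γ => ?_⟩
  have h1 := congrFun hinv γ
  rw [Real.fourierInv_eq'] at h1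
  have hI : Integrable fun ξ : Eucl (n + 1) =>
      Complex.exp (↑(2 * Real.pi * inner ℝ ξ γ) * Complex.I) • A ξ := by
    have hm : Continuous fun ξ : Eucl (n + 1) =>
        Complex.exp (↑(2 * Real.pi * inner ℝ ξ γ) * Complex.I) := by fun_prop
    simp only [smul_eq_mul]
    exact hint.bdd_mul (c := 1) hm.aestronglyMeasurable
      (Eventually.of_forall fun ξ => (Complex.norm_exp_ofReal_mul_I _).le)
  have h2 := congrArg Complex.re h1
  rw [Complex.ofReal_re] at h2
  rw [← h2, ← integral_sub]
  · have := integral_re hI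
    simp only [RCLike.re_to_complex] at this
    rw [← this]
    congr 1 with ξ
    rw [smul_eq_mul, Complex.mul_re, Complex.exp_ofReal_mul_I_re, Complex.exp_ofReal_mul_I_im]
  · exact ha.bdd_mul (c := 1) (by fun_prop) (Eventually.of_forall fun ξ => Real.abs_cos_le_one _)
  · exact hb.bdd_mul (c := 1) (by fun_prop) (Eventually.of_forall fun ξ => Real.abs_sin_le_one _)

variable [CompleteSpace F]

/-- Hence it is orthogonal to the integrable superpositions of plane waves. -/
lemma integral_wave_superposition_eq_zero {f : Eucl (n + 1) → F} (hf : Integrable f)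
    (h : ∀ᵐ s : Metric.sphere (0 : Eucl (n + 1)) 1 ∂(volume : Measure (Eucl (n + 1))).toSphere,
      (s : Eucl (n + 1)) ∈ halfSphere n → ∀ᵐ u, radon f (s, u) = 0) {c : ℝ → ℝ} (hc : Continuous c)
    (hB : ∀ u, ‖c u‖ ≤ 1) {a : Eucl (n + 1) → ℝ} (ha : Integrable a) :
    Integrable (fun γ => (∫ ξ, c (inner ℝ ξ γ) * a ξ) • f γ) ∧
      ∫ γ, (∫ ξ, c (inner ℝ ξ γ) * a ξ) • f γ = 0 := by
  have hI : Integrable (Function.uncurry fun γ ξ : Eucl (n + 1) =>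
      (c (inner ℝ ξ γ) * a ξ) • f γ) (volume.prod volume) := by
    have h1 : Integrable (fun z : Eucl (n + 1) × Eucl (n + 1) => a z.1 • f z.2)
        (volume.prod volume) := ha.smul_prod hf
    have h2 := h1.swap.bdd_smul (φ := fun z => c (inner ℝ z.2 z.1)) 1 (by fun_prop)
      (Eventually.of_forall fun γ => hB _)
    refine h2.congr (Eventually.of_forall fun z => ?_)
    simp [mul_smul, Function.uncurry]
  have hrw : ∀ γ, (∫ ξ, c (inner ℝ ξ γ) * a ξ) • f γ = ∫ ξ, (c (inner ℝ ξ γ) * a ξ) • f γ :=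
    fun γ => (integral_smul_const _ _).symm
  simp only [hrw]
  refine ⟨hI.integral_prod_left, ?_⟩
  rw [integral_integral_swap hI]
  refine integral_eq_zero_of_ae ?_
  filter_upwards [ae_integral_wave_eq_zero hf h hc hB] with ξ hξ
  have : ∀ γ, (c (inner ℝ ξ γ) * a ξ) • f γ = a ξ • (c (inner ℝ ξ γ) • f γ) := fun γ => by
    rw [smul_smul, mul_comm]
  simp only [this, integral_smul, hξ, smul_zero, Pi.zero_apply]

/-- Injectivity of the Radon transform on `L¹`, for functions whose Radon transform is only known
on the half-sphere of directions. The null sets are iterated (almost every `s`, then almost every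
`u`), so that no joint measurability is required. -/
theorem ae_eq_zero_of_radon_ae_eq_zero {f : Eucl (n + 1) → F} (hf : Integrable f)
    (h : ∀ᵐ s : Metric.sphere (0 : Eucl (n + 1)) 1 ∂(volume : Measure (Eucl (n + 1))).toSphere,
      (s : Eucl (n + 1)) ∈ halfSphere n → ∀ᵐ u, radon f (s, u) = 0) : f =ᵐ[volume] 0 := by
  refine ae_eq_zero_of_integral_contDiff_smul_eq_zero hf.locallyIntegrable fun g hg hgc => ?_
  obtain ⟨a, b, ha, hb, hab⟩ := exists_cos_sin_representation hg hgc
  have h1 := integral_wave_superposition_eq_zero hf h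
    (c := fun u => Real.cos (2 * Real.pi * u)) (by fun_prop) (fun u => Real.abs_cos_le_one _) ha
  have h2 := integral_wave_superposition_eq_zero hf h
    (c := fun u => Real.sin (2 * Real.pi * u)) (by fun_prop) (fun u => Real.abs_sin_le_one _) hb
  simp only [hab, sub_smul]
  rw [integral_sub h1.1 h2.1, h1.2, h2.2, sub_zero]

theorem ae_eq_of_radon_ae_eq {f g : Eucl (n + 1) → F} (hf : Integrable f) (hg : Integrable g)
    (h : radon f =ᵐ[radonMeasure n] radon g) : f =ᵐ[volume] g := by
  have h0 : f - g =ᵐ[volume] 0 := by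
    refine ae_eq_zero_of_radon_ae_eq_zero (hf.sub hg) ?_
    filter_upwards [ae_ae_of_ae_radonMeasure h] with s hs hsH
    filter_upwards [hs hsH, radon_sub_ae hf hg s hsH.1] with u h1 h2
    rw [h2, h1, sub_self]
  filter_upwards [h0] with γ hγ using sub_eq_zero.1 hγ

/-- A function in the range of the Radon transform has only one preimage up to null sets. -/
theorem ae_eq_radonInv {f : Eucl (n + 1) → F} (hf : Integrable f) {g : Eucl (n + 1) × ℝ → F}
    (h : radon f =ᵐ[radonMeasure n] g) : InRadonRange g ∧ f =ᵐ[volume] radonInv g := by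
  have hr : InRadonRange g := ⟨f, hf, h⟩
  refine ⟨hr, ?_⟩
  rw [radonInv, dif_pos hr]
  exact ae_eq_of_radon_ae_eq hf hr.choose_spec.1 (h.trans hr.choose_spec.2.symm)

end Injectivity

/-! ### Supports of measures -/

section Support

/-- Two continuous versions of the same function agree everywhere on the support. -/
lemma eqOn_support_of_ae_eq {α β : Type*} [TopologicalSpace α] [MeasurableSpace α]
    [HereditarilyLindelofSpace α] [TopologicalSpace β] [T2Space β] {μ : Measure α} {f g : α → β}
    (hf : ContinuousOn f μ.support) (hg : ContinuousOn g μ.support) (h : f =ᵐ[μ] g) :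
    EqOn f g μ.support := by
  intro p hp
  by_contra hne
  have h1 : ∀ᶠ q in 𝓝[μ.support] p, f q ≠ g q :=
    ((hf p hp).prodMk_nhds (hg p hp)).eventually (isClosed_diagonal.isOpen_compl.mem_nhds hne)
  have h2 : {q | q ∈ μ.support → f q ≠ g q} ∈ 𝓝 p := eventually_nhdsWithin_iff.1 h1
  have h3 := (Measure.mem_support_iff_forall p).1 hp _ h2
  refine h3.ne' (measure_eq_zero_iff_ae_notMem.2 ?_)
  filter_upwards [h, Measure.support_mem_ae (μ := μ)] with q hq hqs hq'
  exact hq' hqs hq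

end Support

/-! ### Zero-extended derivatives -/

section ZeroExt

variable {n : ℕ} {F : Type*} [NormedAddCommGroup F] [NormedSpace ℝ F]

lemma zeroExtDeriv_congr {C : Set (Eucl (n + 1) × ℝ)} {g g' : Eucl (n + 1) × ℝ → F}
    (h : EqOn g g' C) : zeroExtDeriv C g = zeroExtDeriv C g' := by
  ext ⟨s, v⟩
  by_cases hp : (s, v) ∈ C
  · simp only [zeroExtDeriv, if_pos hp]
    exact derivWithin_congr (fun w hw => h hw) (h hp)
  · simp only [zeroExtDeriv, if_neg hp]

lemma derivWithin_eq_zero_of_hasDerivAt_zero {g : ℝ → F} {v : ℝ} {t : Set ℝ}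
    (h : HasDerivAt g 0 v) : derivWithin g t v = 0 := by
  by_cases hu : UniqueDiffWithinAt ℝ t v
  · exact h.hasDerivWithinAt.derivWithin hu
  · exact derivWithin_zero_of_not_uniqueDiffWithinAt hu

/-- If the slice of `C` at `s` contains every value strictly between two values of `⟪s, γ⟫`, `γ ∈ K`,
and `f` vanishes outside `K`, then the zero-extended derivative of `v ↦ ∫_{⟪s, γ⟫ < v} f + c` is the
true derivative wherever the latter exists. -/
lemma zeroExtDeriv_eq_of_hasDerivAt {C : Set (Eucl (n + 1) × ℝ)} {K : Set (Eucl (n + 1))}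
    {f : Eucl (n + 1) → F} (hK : ∀ᵐ γ, γ ∉ K → f γ = 0) {s : Eucl (n + 1)} (hs : s ≠ 0)
    (hfill : ∀ u, ∀ γ₁ ∈ K, ∀ γ₂ ∈ K, inner ℝ s γ₁ < u → u < inner ℝ s γ₂ → (s, u) ∈ C)
    (c : F) {v : ℝ} {r : F} (hr : HasDerivAt (halfSpaceIntegral f s) r v) :
    zeroExtDeriv C (fun p => halfSpaceIntegral f p.1 p.2 + c) (s, v) = r := by
  have hr' := hr.add_const c
  by_cases hlow : ∃ γ₁ ∈ K, inner ℝ s γ₁ < v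
  · by_cases hupp : ∃ γ₂ ∈ K, v < inner ℝ s γ₂
    · -- inside the range of `⟪s, γ⟫`, the slice of `C` is a neighbourhood of `v`
      obtain ⟨γ₁, hγ₁, h1⟩ := hlow
      obtain ⟨γ₂, hγ₂, h2⟩ := hupp
      have hn : {w | (s, w) ∈ C} ∈ 𝓝 v :=
        mem_of_superset (Ioo_mem_nhds h1 h2) fun w hw => hfill w γ₁ hγ₁ γ₂ hγ₂ hw.1 hw.2
      have hm : (s, v) ∈ C := (mem_of_mem_nhds hn :)
      rw [zeroExtDeriv, if_pos hm]
      exact (derivWithin_of_mem_nhds hn).trans hr'.deriv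
    · -- above the range, the half-space carries the whole integral
      push Not at hupp
      have hconst : ∀ w ∈ Ici v, halfSpaceIntegral f s w = ∫ γ, f γ := by
        intro w hw
        rw [halfSpaceIntegral, ← integral_indicator (measurableSet_halfSpace s w)]
        refine integral_congr_ae ?_
        filter_upwards [hK, ae_inner_ne s hs v] with γ hγ hne
        by_cases hγK : γ ∈ K
        · have : inner ℝ s γ < w := ((hupp γ hγK).lt_of_ne hne).trans_le hw
          simp [indicator, this]
        · simp [indicator, hγ hγK]
      have hr0 : r = 0 := by
        have h1 := (hasDerivWithinAt_const v (Ici v) (∫ γ, f γ)).congr hconst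
          (hconst v self_mem_Ici)
        exact (uniqueDiffWithinAt_Ici v).eq_deriv _ hr.hasDerivWithinAt h1
      subst hr0
      rw [zeroExtDeriv]
      split_ifs
      · exact derivWithin_eq_zero_of_hasDerivAt_zero hr'
      · rfl
  · -- below the range, the half-space carries nothing
    push Not at hlow
    have hconst : ∀ w ∈ Iic v, halfSpaceIntegral f s w = 0 := by
      intro w hw
      rw [halfSpaceIntegral, ← integral_indicator (measurableSet_halfSpace s w)]
      refine integral_eq_zero_of_ae ?_
      filter_upwards [hK] with γ hγ
      by_cases hγK : γ ∈ K
      · have : ¬ inner ℝ s γ < w := not_lt.2 (le_trans hw (hlow γ hγK))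
        simp [indicator, this]
      · simp [indicator, hγ hγK]
    have hr0 : r = 0 := by
      have h1 := (hasDerivWithinAt_const v (Iic v) (0 : F)).congr hconst
        (hconst v self_mem_Iic)
      exact (uniqueDiffWithinAt_Iic v).eq_deriv _ hr.hasDerivWithinAt h1
    subst hr0
    rw [zeroExtDeriv]
    split_ifs
    · exact derivWithin_eq_zero_of_hasDerivAt_zero hr'
    · rfl

/-- A closed set whose slices at a dense set of directions contain the range of `⟪s, γ⟫`, `γ ∈ K`,
contains, at every direction, the interior of that range. -/
lemma mem_of_mem_slices_dense {C : Set (Eucl (n + 1) × ℝ)} (hC : IsClosed C)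
    {K G : Set (Eucl (n + 1))}
    (hG : ∀ s ∈ G, ∀ u, ∀ γ₁ ∈ K, ∀ γ₂ ∈ K, inner ℝ s γ₁ < u → u < inner ℝ s γ₂ → (s, u) ∈ C)
    {s : Eucl (n + 1)} (hs : s ∈ closure G) (u : ℝ) (γ₁ : Eucl (n + 1)) (h₁ : γ₁ ∈ K)
    (γ₂ : Eucl (n + 1)) (h₂ : γ₂ ∈ K) (hu₁ : inner ℝ s γ₁ < u) (hu₂ : u < inner ℝ s γ₂) :
    (s, u) ∈ C := by
  have hO : IsOpen {s : Eucl (n + 1) | inner ℝ s γ₁ < u ∧ u < inner ℝ s γ₂} :=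
    IsOpen.inter (isOpen_lt (f := fun s => inner ℝ s γ₁) (g := fun _ => u) (by fun_prop)
      (by fun_prop)) (isOpen_lt (f := fun _ => u) (g := fun s => inner ℝ s γ₂) (by fun_prop)
      (by fun_prop))
  have hmem : s ∈ closure ({s : Eucl (n + 1) | inner ℝ s γ₁ < u ∧ u < inner ℝ s γ₂} ∩ G) :=
    hO.inter_closure ⟨⟨hu₁, hu₂⟩, hs⟩
  have hcl : IsClosed {s : Eucl (n + 1) | (s, u) ∈ C} := hC.preimage (by fun_prop)
  exact closure_minimal (fun t ht => hG t ht.2 u γ₁ h₁ γ₂ h₂ ht.1.1 ht.1.2) hcl hmem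

end ZeroExt

/-! ### Conditional laws and conditional independence -/

section CondDistrib

variable {Ω α β γ : Type*} [MeasurableSpace Ω]
  [MeasurableSpace α] [StandardBorelSpace α] [Nonempty α]
  [MeasurableSpace β] [StandardBorelSpace β] [Nonempty β] [MeasurableSpace γ]
  {P : Measure Ω} [IsFiniteMeasure P] {A : Ω → α} {B : Ω → β} {C : Ω → γ}

/-- Conditional laws only depend on the joint law. -/
lemma condDistrib_eq_of_map_eq {Ω' : Type*} [MeasurableSpace Ω'] {P' : Measure Ω'}
    [IsFiniteMeasure P'] {B' : Ω' → β} {C' : Ω' → γ}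
    (h : P'.map (fun ω => (C' ω, B' ω)) = P.map (fun ω => (C ω, B ω))) :
    condDistrib B' C' P' = condDistrib B C P := by
  rw [condDistrib, condDistrib]
  congr 1

lemma map_compProd_comap {δ ε : Type*} [MeasurableSpace δ] [MeasurableSpace ε] (μ : Measure δ)
    [SFinite μ] {f : δ → γ} (hf : Measurable f) (κ : Kernel γ ε) [IsSFiniteKernel κ] :
    (μ ⊗ₘ κ.comap f hf).map (Prod.map f id) = μ.map f ⊗ₘ κ := by
  ext s hs
  rw [Measure.map_apply (by fun_prop) hs, Measure.compProd_apply (hs.preimage (by fun_prop)),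
    Measure.compProd_apply hs, lintegral_map (Kernel.measurable_kernel_prodMk_left hs) hf]
  rfl

/-- Chain rule for conditional laws. -/
lemma condDistrib_prodMk_ae_eq (hA : Measurable A) (hB : Measurable B) (hC : Measurable C) :
    condDistrib (fun ω => (A ω, B ω)) C P =ᵐ[P.map C]
      condDistrib A C P ⊗ₖ
        (condDistrib B (fun ω => (A ω, C ω)) P).comap Prod.swap measurable_swap := by
  refine condDistrib_ae_eq_of_measure_eq_compProd C (by fun_prop) ?_
  set η := condDistrib B (fun ω => (A ω, C ω)) P
  have h1 : P.map (fun ω => (C ω, A ω)) ⊗ₘ η.comap Prod.swap measurable_swap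
      = P.map (fun ω => ((C ω, A ω), B ω)) := by
    have h2 := map_compProd_comap (P.map (fun ω => (C ω, A ω))) measurable_swap η
    rw [Measure.map_map measurable_swap (by fun_prop)] at h2
    have h3 : P.map (Prod.swap ∘ fun ω => (C ω, A ω)) ⊗ₘ η = _ :=
      compProd_map_condDistrib hB.aemeasurable
    rw [h3] at h2
    have h4 := congrArg (Measure.map (Prod.map Prod.swap (id : β → β))) h2
    rw [Measure.map_map (by fun_prop) (by fun_prop), Measure.map_map (by fun_prop) (by fun_prop)]
      at h4
    have h5 : Prod.map Prod.swap (id : β → β) ∘ Prod.map (Prod.swap : γ × α → α × γ) id = id := by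
      ext x <;> rfl
    rw [h5, Measure.map_id] at h4
    exact h4
  have h6 := Measure.compProd_assoc (μ := P.map C) (κ := condDistrib A C P)
    (η := η.comap Prod.swap measurable_swap)
  rw [compProd_map_condDistrib hA.aemeasurable, h1] at h6
  have h7 := congrArg (Measure.map MeasurableEquiv.prodAssoc) h6
  rw [MeasurableEquiv.map_map_symm, Measure.map_map (by fun_prop) (by fun_prop)] at h7
  exact h7.symm

/-- Conditional independence is inherited by functions of the two variables. -/
lemma CondIndepGiven.comp {α' β' : Type*} [MeasurableSpace α'] [StandardBorelSpace α'] [Nonempty α']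
    [MeasurableSpace β'] [StandardBorelSpace β'] [Nonempty β'] (h : CondIndepGiven P A B C)
    (hA : Measurable A) (hB : Measurable B)
    {f : α → α'} {g : β → β'} (hf : Measurable f) (hg : Measurable g) :
    CondIndepGiven P (fun ω => f (A ω)) (fun ω => g (B ω)) C := by
  have h1 := condDistrib_comp (mβ := inferInstance) (μ := P) C (hA.prodMk hB).aemeasurable
    (hf.prodMap hg)
  filter_upwards [h, h1, condDistrib_comp (mβ := inferInstance) (μ := P) C hA.aemeasurable hf,
    condDistrib_comp (mβ := inferInstance) (μ := P) C hB.aemeasurable hg] with c hc h1 h2 h3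
  have h1' : condDistrib (fun ω => (f (A ω), g (B ω))) C P c
      = ((condDistrib (fun ω => (A ω, B ω)) C P).map (Prod.map f g)) c := h1
  have h2' : condDistrib (fun ω => f (A ω)) C P c = ((condDistrib A C P).map f) c := h2
  have h3' : condDistrib (fun ω => g (B ω)) C P c = ((condDistrib B C P).map g) c := h3
  rw [h1', h2', h3', Kernel.map_apply _ (hf.prodMap hg), Kernel.map_apply _ hf,
    Kernel.map_apply _ hg, hc, Measure.map_prod_map _ _ hf hg]

/-- If `A` and `B` are independent given `C`, the law of `B` given `(A, C)` only depends on `C`.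
The pair `(A, C)` may be coded by any measurable `T (A, C)` from which `C` can be recovered. -/
lemma CondIndepGiven.condDistrib_ae_eq (h : CondIndepGiven P A B C)
    (hA : Measurable A) (hB : Measurable B) (hC : Measurable C)
    {τ : Type*} [MeasurableSpace τ] {T : α × γ → τ} (hT : Measurable T) {q : τ → γ}
    (hq : Measurable q) (hqT : ∀ p, q (T p) = p.2) :
    condDistrib B (fun ω => T (A ω, C ω)) P =ᵐ[P.map (fun ω => T (A ω, C ω))]
      (condDistrib B C P).comap q hq := by
  refine condDistrib_ae_eq_of_measure_eq_compProd _ hB.aemeasurable ?_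
  have h1 : P.map (fun ω => (C ω, (A ω, B ω)))
      = P.map C ⊗ₘ (condDistrib A C P ×ₖ condDistrib B C P) := by
    rw [← compProd_map_condDistrib (X := C) (Y := fun ω => (A ω, B ω)) (by fun_prop)]
    refine Measure.compProd_congr ?_
    filter_upwards [h] with c hc
    rw [hc, Kernel.prod_apply]
  ext s hs
  have hs' : MeasurableSet ((fun p : γ × α × β => (T (p.2.1, p.1), p.2.2)) ⁻¹' s) :=
    hs.preimage (by fun_prop)
  have e1 : P.map (fun ω => (T (A ω, C ω), B ω)) s = P.map (fun ω => (C ω, (A ω, B ω)))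
      ((fun p : γ × α × β => (T (p.2.1, p.1), p.2.2)) ⁻¹' s) := by
    rw [Measure.map_apply (by fun_prop) hs, Measure.map_apply (by fun_prop) hs']
    rfl
  have hm : Measurable fun t => condDistrib B C P (q t) (Prod.mk t ⁻¹' s) :=
    Kernel.measurable_kernel_prodMk_left (κ := (condDistrib B C P).comap q hq) hs
  have hm' : Measurable fun p : γ × α =>
      condDistrib B C P (q (T (p.2, p.1))) (Prod.mk (T (p.2, p.1)) ⁻¹' s) :=
    hm.comp (hT.comp measurable_swap)
  have e2 : (P.map (fun ω => T (A ω, C ω)) ⊗ₘ (condDistrib B C P).comap q hq) s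
      = ∫⁻ p, condDistrib B C P (q (T (p.2, p.1))) (Prod.mk (T (p.2, p.1)) ⁻¹' s)
        ∂(P.map fun ω => (C ω, A ω)) := by
    rw [lintegral_map hm' (by fun_prop), Measure.compProd_apply hs]
    exact lintegral_map hm (by fun_prop)
  rw [e1, h1, e2, ← compProd_map_condDistrib (X := C) (Y := A) hA.aemeasurable,
    Measure.compProd_apply hs', Measure.lintegral_compProd hm']
  refine lintegral_congr fun c => ?_
  rw [Kernel.prod_apply, Measure.prod_apply (measurable_prodMk_left hs')]
  simp only [hqT]
  rfl

lemma ae_condDistrib_of_forall (hB : Measurable B) {p : β → Prop} (hp : MeasurableSet {b | p b})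
    (h : ∀ ω, p (B ω)) : ∀ᵐ c ∂P.map C, ∀ᵐ b ∂condDistrib B C P c, p b := by
  by_cases hC : AEMeasurable C P
  · have h1 : ∀ᵐ z ∂(P.map C ⊗ₘ condDistrib B C P), p z.2 := by
      rw [compProd_map_condDistrib hB.aemeasurable]
      exact (ae_map_iff (hC.prodMk hB.aemeasurable) (hp.preimage measurable_snd)).2
        (Eventually.of_forall h)
    exact Measure.ae_ae_of_ae_compProd h1
  · simp [Measure.map_of_not_aemeasurable hC]

end CondDistrib

/-! ### The selection model in normalized variables -/

section Append

variable {n : ℕ}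

lemma appendLast_castSucc (z : Eucl n) (t : ℝ) (i : Fin n) :
    appendLast z t i.castSucc = z i := by
  simp [appendLast]

lemma appendLast_last (z : Eucl n) (t : ℝ) : appendLast z t (Fin.last n) = t := by
  simp [appendLast]

lemma measurable_appendLast : Measurable fun p : Eucl n × ℝ => appendLast p.1 p.2 := by
  refine (PiLp.volume_preserving_toLp (Fin (n + 1))).measurable.comp (measurable_pi_iff.2 ?_)
  intro i
  refine Fin.lastCases ?_ (fun i => ?_) i
  · simpa using measurable_snd
  · simp only [Fin.snoc_castSucc]; fun_prop

lemma inner_appendLast (z z' : Eucl n) (t t' : ℝ) :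
    inner ℝ (appendLast z t) (appendLast z' t') = inner ℝ z z' + t * t' := by
  simp [PiLp.inner_apply, Fin.sum_univ_castSucc, appendLast_castSucc, appendLast_last, mul_comm]

lemma appendLast_one_ne_zero (z : Eucl n) : appendLast z 1 ≠ 0 := by
  intro h
  have := appendLast_last z 1
  simp [h] at this

end Append

namespace SelectionModel

variable {n : ℕ} {Ω 𝒳 : Type*} [MeasurableSpace Ω] [MeasurableSpace 𝒳]
  (M : SelectionModel n Ω 𝒳)

attribute [fun_prop] measurable_Y₀ measurable_Y₁ measurable_V measurable_Z measurable_Γ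
  measurable_Θ measurable_X₀ measurable_X₁

@[fun_prop]
lemma measurable_D : Measurable M.D := by
  unfold D
  refine Measurable.ite (measurableSet_lt measurable_const ?_) measurable_const measurable_const
  exact (M.measurable_V.sub (M.measurable_Z.inner M.measurable_Γ)).sub M.measurable_Θ

@[fun_prop]
lemma measurable_Y : Measurable M.Y :=
  M.measurable_Y₀.add ((M.measurable_Y₁.sub M.measurable_Y₀).mul M.measurable_D)

@[fun_prop]
lemma measurable_X : Measurable M.X := by
  unfold X
  exact Measurable.ite (M.measurable_D (measurableSet_singleton 1)) M.measurable_X₁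
    M.measurable_X₀

/-- The map `(V, Z) ↦ (S̃, Ṽ)`. -/
noncomputable def normalize (p : ℝ × Eucl n) : Eucl (n + 1) × ℝ :=
  (‖appendLast p.2 1‖⁻¹ • appendLast p.2 1, p.1 / ‖appendLast p.2 1‖)

lemma measurable_normalize : Measurable (normalize (n := n)) := by
  have h : Measurable fun p : ℝ × Eucl n => appendLast p.2 (1 : ℝ) :=
    measurable_appendLast.comp (measurable_snd.prodMk measurable_const)
  exact (h.norm.inv.smul h).prodMk (measurable_fst.div h.norm)

lemma normalize_eq (ω : Ω) : normalize (M.V ω, M.Z ω) = (M.St ω, M.Vt ω) := rfl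

lemma measurable_SV : Measurable fun ω => (M.St ω, M.Vt ω) := by
  have h : Measurable fun ω => normalize (M.V ω, M.Z ω) :=
    measurable_normalize.comp (M.measurable_V.prodMk M.measurable_Z)
  simpa only [normalize_eq] using h

@[fun_prop]
lemma measurable_St : Measurable M.St := measurable_fst.comp M.measurable_SV

@[fun_prop]
lemma measurable_Vt : Measurable M.Vt := measurable_snd.comp M.measurable_SV

@[fun_prop]
lemma measurable_Γt : Measurable M.Γt :=
  measurable_appendLast.comp (M.measurable_Γ.prodMk M.measurable_Θ)

lemma norm_St (ω : Ω) : ‖M.St ω‖ = 1 := by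
  rw [St, norm_smul, norm_inv, norm_norm,
    inv_mul_cancel₀ (norm_ne_zero_iff.2 (appendLast_one_ne_zero _))]

/-- In normalized variables, `D = 1{⟪S̃, Γ̃⟫ < Ṽ}`. -/
lemma D_eq_ite (ω : Ω) [Decidable (inner ℝ (M.St ω) (M.Γt ω) < M.Vt ω)] :
    M.D ω = if inner ℝ (M.St ω) (M.Γt ω) < M.Vt ω then 1 else 0 := by
  have hpos : 0 < ‖appendLast (M.Z ω) 1‖ := norm_pos_iff.2 (appendLast_one_ne_zero _)
  have : (0 < M.V ω - inner ℝ (M.Z ω) (M.Γ ω) - M.Θ ω) ↔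
      inner ℝ (M.St ω) (M.Γt ω) < M.Vt ω := by
    rw [St, Vt, Γt, inner_smul_left, inner_appendLast, conj_trivial, inv_mul_eq_div,
      div_lt_div_iff_of_pos_right hpos, one_mul, sub_sub, sub_pos]
  rw [D]
  exact if_congr this rfl rfl

lemma D_smul_comp_Y {F : Type*} [AddCommGroup F] [Module ℝ F] (φ : ℝ → F) (ω : Ω) :
    M.D ω • φ (M.Y ω) = (M.D ω - 0) • φ (M.Y₁ ω) := by
  classical
  rw [Y]
  rcases (by rw [D]; split_ifs <;> simp : M.D ω = 0 ∨ M.D ω = 1) with h | h <;> simp [h]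

lemma D_sub_one_smul_comp_Y {F : Type*} [AddCommGroup F] [Module ℝ F] (φ : ℝ → F) (ω : Ω) :
    (M.D ω - 1) • φ (M.Y ω) = (M.D ω - 1) • φ (M.Y₀ ω) := by
  classical
  rw [Y]
  rcases (by rw [D]; split_ifs <;> simp : M.D ω = 0 ∨ M.D ω = 1) with h | h <;> simp [h]

instance : IsProbabilityMeasure M.lawX := Measure.isProbabilityMeasure_map (by fun_prop)

variable {M}

/-- The random coefficients have a conditional density. -/
lemma InstrumentAssumption.absolutelyContinuous_Γt (hM : M.InstrumentAssumption) :
    ∀ᵐ x ∂M.lawX, condDistrib M.Γt M.X M.P x ≪ volume := by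
  have h := condDistrib_comp (mβ := inferInstance) (μ := M.P) M.X
    (Y := fun ω => (M.St ω, M.Vt ω, M.Γt ω)) (by fun_prop)
    (f := fun p : Eucl (n + 1) × ℝ × Eucl (n + 1) => p.2.2) (by fun_prop)
  filter_upwards [hM.absolutelyContinuous, h] with x hx h
  have h' : condDistrib M.Γt M.X M.P x = ((condDistrib (fun ω => (M.St ω, M.Vt ω, M.Γt ω)) M.X
    M.P).map (fun p : Eucl (n + 1) × ℝ × Eucl (n + 1) => p.2.2)) x := h
  rw [h', Kernel.map_apply _ (by fun_prop)]
  refine (hx.map (by fun_prop)).trans ?_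
  refine Measure.AbsolutelyContinuous.mk fun N hN hN0 => ?_
  rw [Measure.map_apply (by fun_prop) hN]
  have : (fun p : Eucl (n + 1) × ℝ × Eucl (n + 1) => p.2.2) ⁻¹' N = univ ×ˢ univ ×ˢ N := by
    ext p; simp
  rw [this, Measure.prod_prod, Measure.prod_prod, hN0]
  simp

/-- The slices of the support of `(S̃, Ṽ)` given `X = x` contain the conditional supports of `Ṽ`
given `S̃ = s, X = x`. -/
lemma ae_support_Vt_subset (M : SelectionModel n Ω 𝒳) :
    ∀ᵐ x ∂M.lawX, ∀ᵐ s ∂condDistrib M.St M.X M.P x,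
      (condDistrib M.Vt (fun ω => (M.St ω, M.X ω)) M.P (s, x)).support ⊆
        {v | (s, v) ∈ M.suppSV x} := by
  filter_upwards [condDistrib_prodMk_ae_eq M.measurable_St M.measurable_Vt M.measurable_X]
    with x hx
  have h1 : ∀ᵐ p ∂condDistrib (fun ω => (M.St ω, M.Vt ω)) M.X M.P x, p ∈ M.suppSV x :=
    Measure.support_mem_ae
  rw [hx] at h1
  filter_upwards [Kernel.ae_ae_of_ae_compProd h1] with s hs
  refine Measure.support_subset_of_isClosed ?_ hs
  exact Measure.isClosed_support.preimage (by fun_prop)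

/-- Under large support, the support of `(S̃, Ṽ)` given `X = x` contains, at every direction of the
half-sphere, the interior of the range of `⟪s, γ⟫`. -/
lemma LargeSupport.mem_suppSV (hS : M.LargeSupport) :
    ∀ᵐ x ∂M.lawX, ∀ s ∈ halfSphere n, ∀ u, ∀ γ₁ ∈ M.suppΓt x, ∀ γ₂ ∈ M.suppΓt x,
      inner ℝ s γ₁ < u → u < inner ℝ s γ₂ → (s, u) ∈ M.suppSV x := by
  have h1 := hS.support_Vt
  have h2 : M.P.map (fun ω => (M.St ω, M.X ω))
      = (M.lawX ⊗ₘ condDistrib M.St M.X M.P).map Prod.swap := by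
    rw [lawX, compProd_map_condDistrib (by fun_prop), Measure.map_map (by fun_prop) (by fun_prop)]
    rfl
  rw [h2] at h1
  have h3 := Measure.ae_ae_of_ae_compProd (ae_of_ae_map measurable_swap.aemeasurable h1)
  filter_upwards [h3, ae_support_Vt_subset M, hS.support_St] with x hx1 hx2 hx3 s hs
  have hcl : halfSphere n ⊆ closure _ := subset_closure.trans (hx3 ▸
    Measure.support_subset_of_isClosed isClosed_closure
      (mem_of_superset (hx1.and hx2) subset_closure))
  refine mem_of_mem_slices_dense Measure.isClosed_support ?_ (hcl hs)
  rintro t ⟨ht1, ht2⟩ u γ₁ h₁ γ₂ h₂ hu₁ hu₂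
  refine ht2 (ht1 ⟨?_, ?_⟩)
  · exact (iInf₂_le γ₁ h₁).trans (EReal.coe_le_coe_iff.2 hu₁.le)
  · exact (EReal.coe_le_coe_iff.2 hu₂.le).trans
      (le_iSup₂ (f := fun γ (_ : γ ∈ M.suppΓt x) => ((inner ℝ t γ : ℝ) : EReal)) γ₂ h₂)

/-- Conditionally on `X`, the normalized instruments are independent of `(Γ̃, U)`. -/
lemma condIndepGiven_normalized {U : Ω → ℝ} (hU : Measurable U)
    (h : CondIndepGiven M.P (fun ω => (M.V ω, M.Z ω)) (fun ω => (U ω, M.Γ ω, M.Θ ω)) M.X) :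
    CondIndepGiven M.P (fun ω => (M.St ω, M.Vt ω)) (fun ω => (M.Γt ω, U ω)) M.X :=
  h.comp (M.measurable_V.prodMk M.measurable_Z)
    (hU.prodMk (M.measurable_Γ.prodMk M.measurable_Θ)) measurable_normalize
    (g := fun b : ℝ × Eucl n × ℝ => (appendLast b.2.1 b.2.2, b.1))
    ((measurable_appendLast.comp measurable_snd).prodMk measurable_fst)

end SelectionModel

/-! ### Regression functions, inversion and identification -/

namespace SelectionModel

variable {n : ℕ} {Ω 𝒳 : Type*} [MeasurableSpace Ω] [MeasurableSpace 𝒳]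
  {M : SelectionModel n Ω 𝒳}

/-- The density vanishes outside the support, so the extension by `0` in `condMeanDensity` changes
nothing up to null sets. -/
lemma ae_condDensity_eq_zero (M : SelectionModel n Ω 𝒳) (x : 𝒳) :
    ∀ᵐ γ, γ ∉ M.suppΓt x → M.condDensity x γ = 0 := by
  have hms : MeasurableSet (M.suppΓt x)ᶜ := Measure.isClosed_support.measurableSet.compl
  have h0 : ∫⁻ γ in (M.suppΓt x)ᶜ, (condDistrib M.Γt M.X M.P x).rnDeriv volume γ = 0 :=
    le_antisymm ((Measure.setLIntegral_rnDeriv_le _).trans Measure.measure_compl_support.le) zero_le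
  rw [lintegral_eq_zero_iff (Measure.measurable_rnDeriv _ _)] at h0
  filter_upwards [(ae_restrict_iff' hms).1 h0] with γ hγ hγs
  rw [condDensity, hγ hγs]
  rfl

section Inversion

variable {F : Type*} [NormedAddCommGroup F] [NormedSpace ℝ F]
  {U : Ω → ℝ} {φ : ℝ → F}

open Classical in
/-- The difference of `1{⟪s, γ⟫ < v}` and the constant `c`, times `φ y`. With `c = 0` and `c = 1`
these are the contributions to `φ(Y) D` and `φ(Y) (D - 1)` of a value `(γ, y)` of `(Γ̃, Y_j)`. -/
noncomputable def selectedOutcome (φ : ℝ → F) (c : ℝ) (s : Eucl (n + 1)) (v : ℝ)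
    (b : Eucl (n + 1) × ℝ) : F :=
  ((if inner ℝ s b.1 < v then 1 else 0) - c) • φ b.2

lemma stronglyMeasurable_selectedOutcome (hφ : StronglyMeasurable φ) (c : ℝ) :
    StronglyMeasurable fun p : (Eucl (n + 1) × ℝ × 𝒳) × Eucl (n + 1) × ℝ =>
      selectedOutcome φ c p.1.1 p.1.2.1 p.2 := by
  unfold selectedOutcome
  refine StronglyMeasurable.smul (Measurable.stronglyMeasurable ?_)
    (hφ.comp_measurable (by fun_prop))
  exact (Measurable.ite (measurableSet_lt (by fun_prop) (by fun_prop)) measurable_const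
    measurable_const).sub_const c

/-- The regression function of `(D - c) φ(U)`, computed from the conditional law of `(Γ̃, U)`. -/
noncomputable def regressionVersion (M : SelectionModel n Ω 𝒳) (U : Ω → ℝ) (φ : ℝ → F) (c : ℝ)
    (p : Eucl (n + 1) × ℝ × 𝒳) : F :=
  ∫ b, selectedOutcome φ c p.1 p.2.1 b ∂condDistrib (fun ω => (M.Γt ω, U ω)) M.X M.P p.2.2

lemma stronglyMeasurable_regressionVersion (hφ : StronglyMeasurable φ) (c : ℝ) :
    StronglyMeasurable (M.regressionVersion U φ c) := by
  have h := StronglyMeasurable.integral_kernel_prod_right'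
    (κ := (condDistrib (fun ω => (M.Γt ω, U ω)) M.X M.P).comap
      (fun p : Eucl (n + 1) × ℝ × 𝒳 => p.2.2) (by fun_prop))
    (stronglyMeasurable_selectedOutcome (n := n) (𝒳 := 𝒳) hφ c)
  exact h

lemma selectedOutcome_eq (φ : ℝ → F) (c : ℝ) (ω : Ω) :
    selectedOutcome φ c (M.St ω) (M.Vt ω) (M.Γt ω, U ω) = (M.D ω - c) • φ (U ω) := by
  classical
  rw [selectedOutcome, M.D_eq_ite]

lemma integrable_sub_smul (hi : Integrable (fun ω => φ (U ω)) M.P) (c : ℝ) :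
    Integrable (fun ω => (M.D ω - c) • φ (U ω)) M.P := by
  classical
  refine hi.bdd_smul (φ := fun ω => M.D ω - c) (1 + ‖c‖)
    (M.measurable_D.sub_const c).aestronglyMeasurable (Eventually.of_forall fun ω => ?_)
  refine (norm_sub_le _ _).trans (add_le_add_left ?_ _)
  rw [D]; split_ifs <;> simp

lemma stronglyMeasurable_condMeanDensity (hφ : StronglyMeasurable φ) (x : 𝒳) :
    StronglyMeasurable (M.condMeanDensity U φ x) := by
  unfold condMeanDensity
  refine StronglyMeasurable.smul ?_ (StronglyMeasurable.indicator ?_ ?_)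
  · exact (Measure.measurable_rnDeriv _ _).ennreal_toReal.stronglyMeasurable
  · have := (hφ.comp_measurable
      (measurable_snd : Measurable fun p : (Eucl (n + 1) × 𝒳) × ℝ => p.2)).integral_condDistrib
      (Y := U) (X := fun ω => (M.Γt ω, M.X ω)) (μ := M.P)
    exact this.comp_measurable (measurable_id.prodMk measurable_const)
  · exact Measure.isClosed_support.measurableSet

/-- Integrating out `U` given `(Γ̃, X)`: the regression function is an integral over a half-space
of `condMeanDensity`, up to a constant in `(s, v)`. -/
lemma ae_regressionVersion_eq (hM : M.InstrumentAssumption) (hU : Measurable U)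
    (hφ : StronglyMeasurable φ) (hi : Integrable (fun ω => φ (U ω)) M.P) (c : ℝ) :
    ∀ᵐ x ∂M.lawX, Integrable (M.condMeanDensity U φ x) ∧ ∀ s v,
      M.regressionVersion U φ c (s, v, x) = halfSpaceIntegral (M.condMeanDensity U φ x) s v +
        (-c) • ∫ γ, M.condMeanDensity U φ x γ := by
  classical
  have hi' : Integrable (fun p : 𝒳 × Eucl (n + 1) × ℝ => φ p.2.2)
      (M.P.map fun ω => (M.X ω, M.Γt ω, U ω)) :=
    (integrable_map_measure (hφ.comp_measurable (by fun_prop)).aestronglyMeasurable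
      (by fun_prop)).2 hi
  filter_upwards [condDistrib_prodMk_ae_eq M.measurable_Γt hU M.measurable_X,
    hi'.condDistrib_ae_map (by fun_prop), hM.absolutelyContinuous_Γt] with x hx hix hac
  set κ := condDistrib M.Γt M.X M.P x with hκ
  set g : Eucl (n + 1) → F := fun γ =>
    ∫ y, φ y ∂(condDistrib U (fun ω => (M.Γt ω, M.X ω)) M.P (γ, x)) with hg
  have hind : ∀ w : Eucl (n + 1) → ℝ,
      (fun γ => w γ • M.condMeanDensity U φ x γ) =ᵐ[volume]
        fun γ => (κ.rnDeriv volume γ).toReal • (w γ • g γ) := by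
    intro w
    filter_upwards [M.ae_condDensity_eq_zero x] with γ hγ
    by_cases hs : γ ∈ M.suppΓt x
    · simp only [condMeanDensity, indicator_of_mem hs, smul_smul, mul_comm (w γ)]
      rfl
    · have h0 := hγ hs
      simp only [condMeanDensity, h0]
      rw [condDensity] at h0
      rw [hκ, h0]
      simp
  have hgi : Integrable g κ := by
    rw [hx] at hix
    exact hix.integral_compProd
  have hTi : Integrable (M.condMeanDensity U φ x) := by
    have h1 := (integrable_rnDeriv_smul_iff (f := g) hac).2 hgi
    refine h1.congr ?_
    filter_upwards [hind fun _ => 1] with γ hγ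
    simpa using hγ.symm
  refine ⟨hTi, fun s v => ?_⟩
  have hsel : Integrable (selectedOutcome φ c s v)
      (condDistrib (fun ω => (M.Γt ω, U ω)) M.X M.P x) := by
    refine hix.bdd_smul (φ := fun b : Eucl (n + 1) × ℝ => (if inner ℝ s b.1 < v then 1 else 0) - c)
      (1 + ‖c‖) ?_ (Eventually.of_forall fun b => ?_)
    · exact ((Measurable.ite (measurableSet_lt (by fun_prop) (by fun_prop)) measurable_const
        measurable_const).sub_const c).aestronglyMeasurable
    · refine (norm_sub_le _ _).trans (add_le_add_left ?_ _)
      split_ifs <;> simp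
  calc M.regressionVersion U φ c (s, v, x)
      = ∫ γ, ((if inner ℝ s γ < v then 1 else 0) - c) • g γ ∂κ := by
        unfold regressionVersion
        simp only
        rw [hx] at hsel ⊢
        rw [integral_compProd hsel]
        refine integral_congr_ae (Eventually.of_forall fun γ => ?_)
        exact integral_smul (μ := condDistrib U (fun ω => (M.Γt ω, M.X ω)) M.P (γ, x))
          ((if inner ℝ s γ < v then (1 : ℝ) else 0) - c) φ
    _ = ∫ γ, ((if inner ℝ s γ < v then 1 else 0) - c) • M.condMeanDensity U φ x γ := by
        rw [← integral_rnDeriv_smul hac]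
        exact integral_congr_ae (hind fun γ => (if inner ℝ s γ < v then 1 else 0) - c).symm
    _ = halfSpaceIntegral (M.condMeanDensity U φ x) s v +
        (-c) • ∫ γ, M.condMeanDensity U φ x γ := by
        rw [halfSpaceIntegral, ← integral_indicator (measurableSet_halfSpace s v),
          ← integral_smul]
        refine Eq.trans ?_ (integral_add (hTi.indicator (measurableSet_halfSpace s v))
          (hTi.smul (-c)))
        congr 1 with γ
        by_cases h : inner ℝ s γ < v <;> simp [h, indicator, add_smul, sub_eq_add_neg]

lemma ae_norm_eq_one_of_mem_suppSV (M : SelectionModel n Ω 𝒳) :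
    ∀ᵐ x ∂M.lawX, ∀ p ∈ M.suppSV x, ‖p.1‖ = 1 := by
  have hcl : IsClosed {p : Eucl (n + 1) × ℝ | ‖p.1‖ = 1} :=
    isClosed_eq (by fun_prop) continuous_const
  have := ae_condDistrib_of_forall (P := M.P) (C := M.X) M.measurable_SV (p := fun p => ‖p.1‖ = 1)
    hcl.measurableSet (fun ω => M.norm_St ω)
  filter_upwards [this] with x hx
  exact Measure.support_subset_of_isClosed hcl hx

/-- Instrument independence gives a version of the regression function that is continuous at every
unit direction. -/
lemma isRegression_regressionVersion [CompleteSpace F] (hM : M.InstrumentAssumption)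
    (hU : Measurable U)
    (hindep : CondIndepGiven M.P (fun ω => (M.V ω, M.Z ω)) (fun ω => (U ω, M.Γ ω, M.Θ ω)) M.X)
    (hφ : StronglyMeasurable φ) (hi : Integrable (fun ω => φ (U ω)) M.P) (c : ℝ) :
    M.IsRegression (fun ω => (M.D ω - c) • φ (U ω)) (M.regressionVersion U φ c) where
  stronglyMeasurable := stronglyMeasurable_regressionVersion hφ c
  condExp_eq := by
    have hT : Measurable fun ω => (M.St ω, M.Vt ω, M.X ω) := by fun_prop
    have h1 := condExp_prod_ae_eq_integral_condDistrib (μ := M.P)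
      (X := fun ω => (M.St ω, M.Vt ω, M.X ω)) (Y := fun ω => (M.Γt ω, U ω)) hT (by fun_prop)
      (stronglyMeasurable_selectedOutcome (n := n) (𝒳 := 𝒳) hφ c) (by
        simp only [selectedOutcome_eq]; exact integrable_sub_smul hi c)
    simp only [selectedOutcome_eq] at h1
    refine EventuallyEq.trans ?_ h1.symm
    have h2 := (condIndepGiven_normalized hU hindep).condDistrib_ae_eq M.measurable_SV
      (M.measurable_Γt.prodMk hU) M.measurable_X
      (T := fun p : (Eucl (n + 1) × ℝ) × 𝒳 => (p.1.1, p.1.2, p.2)) (by fun_prop)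
      (q := fun t => t.2.2) (by fun_prop) (fun _ => rfl)
    filter_upwards [ae_of_ae_map hT.aemeasurable h2] with ω hω
    rw [hω]
    rfl
  continuousOn := by
    filter_upwards [ae_regressionVersion_eq hM hU hφ hi c, ae_norm_eq_one_of_mem_suppSV M]
      with x hx hx1 p hp
    have hp0 : p.1 ≠ 0 := by
      intro h; have := hx1 p hp; simp [h] at this
    simp only [hx.2]
    exact ((continuousAt_halfSpaceIntegral hx.1 hp0).add continuousAt_const).continuousWithinAt

/-- Two continuous versions of the regression function agree on the support of `(S̃, Ṽ)`. -/
lemma IsRegression.ae_eqOn {W : Ω → F} {m m' : Eucl (n + 1) × ℝ × 𝒳 → F}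
    (h : M.IsRegression W m) (h' : M.IsRegression W m') :
    ∀ᵐ x ∂M.lawX, EqOn (fun p => m (p.1, p.2, x)) (fun p => m' (p.1, p.2, x)) (M.suppSV x) := by
  have h1 := h.condExp_eq.trans h'.condExp_eq.symm
  have h2 : ∀ᵐ q ∂M.P.map (fun ω => (M.X ω, (M.St ω, M.Vt ω))),
      m (q.2.1, q.2.2, q.1) = m' (q.2.1, q.2.2, q.1) := by
    rw [ae_map_iff (by fun_prop)]
    · exact h1
    · exact StronglyMeasurable.measurableSet_eq_fun
        (h.stronglyMeasurable.comp_measurable (by fun_prop))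
        (h'.stronglyMeasurable.comp_measurable (by fun_prop))
  rw [← compProd_map_condDistrib (by fun_prop)] at h2
  filter_upwards [Measure.ae_ae_of_ae_compProd h2, h.continuousOn, h'.continuousOn]
    with x hx hc hc'
  exact eqOn_support_of_ae_eq hc hc' hx

/-- The inversion formula for `W = (D - c) φ(U)`, when `(V, Z)` is independent of `(U, Γ, Θ)`
given `X`. -/
theorem eqRadonInvDeriv_sub_smul [CompleteSpace F] (hM : M.InstrumentAssumption)
    (hS : M.LargeSupport) (hU : Measurable U)
    (hindep : CondIndepGiven M.P (fun ω => (M.V ω, M.Z ω)) (fun ω => (U ω, M.Γ ω, M.Θ ω)) M.X)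
    (hφ : StronglyMeasurable φ) (hi : Integrable (fun ω => φ (U ω)) M.P) (c : ℝ) :
    M.EqRadonInvDeriv (fun ω => (M.D ω - c) • φ (U ω)) (M.condMeanDensity U φ) := by
  have hreg := isRegression_regressionVersion hM hU hindep hφ hi c
  refine ⟨⟨_, hreg⟩, fun m hm => ?_⟩
  filter_upwards [hm.ae_eqOn hreg, ae_regressionVersion_eq hM hU hφ hi c, hS.mem_suppSV]
    with x hmx ⟨hTi, hx⟩ hfill
  refine ae_eq_radonInv hTi ?_
  rw [zeroExtDeriv_congr hmx]
  simp only [hx]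
  have hK : ∀ᵐ γ, γ ∉ M.suppΓt x → M.condMeanDensity U φ x γ = 0 :=
    Eventually.of_forall fun γ hγ => by simp [condMeanDensity, hγ]
  have hH : ∀ᵐ p ∂radonMeasure n, p.1 ∈ halfSphere n :=
    Measure.quasiMeasurePreserving_fst.ae (ae_restrict_mem measurableSet_halfSphere)
  filter_upwards [ae_hasDerivAt_radon hTi (stronglyMeasurable_condMeanDensity hφ x), hH]
    with p hp hps
  have hs0 : p.1 ≠ 0 := by
    intro h; have := hps.1; simp [h] at this
  exact (zeroExtDeriv_eq_of_hasDerivAt hK hs0 (hfill p.1 hps) _ hp).symm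

end Inversion

section Identification

variable {F : Type*} [NormedAddCommGroup F] [NormedSpace ℝ F]

lemma EqRadonInvDeriv.congr {W : Ω → F} {T T' : 𝒳 → Eucl (n + 1) → F}
    (h : M.EqRadonInvDeriv W T) (hT : ∀ x, T' x =ᵐ[volume] T x) : M.EqRadonInvDeriv W T' :=
  ⟨h.1, fun m hm => (h.2 m hm).mono fun x hx => ⟨hx.1, (hT x).trans hx.2⟩⟩

lemma map_observables_eq {Ω' : Type*} [MeasurableSpace Ω'] {M' : SelectionModel n Ω' 𝒳}
    (h : M'.observedLaw = M.observedLaw) {τ : Type*} [MeasurableSpace τ]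
    {r : ℝ × ℝ × ℝ × Eucl n × 𝒳 → τ} (hr : Measurable r) :
    M'.P.map (fun ω => r (M'.Y ω, M'.D ω, M'.V ω, M'.Z ω, M'.X ω))
      = M.P.map (fun ω => r (M.Y ω, M.D ω, M.V ω, M.Z ω, M.X ω)) := by
  have := congrArg (Measure.map r) h
  rwa [observedLaw, observedLaw, Measure.map_map hr (by fun_prop), Measure.map_map hr (by fun_prop)]
    at this

/-- The regression functions and the supports of the instruments, hence the zero-extended
derivatives, only depend on the law of the observables. -/
theorem EqRadonInvDeriv.identified [CompleteSpace F] {Ω' : Type*} [MeasurableSpace Ω']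
    {M' : SelectionModel n Ω' 𝒳}
    (hlaw : M'.observedLaw = M.observedLaw) {k : ℝ × ℝ → F} (hk : StronglyMeasurable k)
    (hi : Integrable (fun ω => k (M.Y ω, M.D ω)) M.P)
    {T T' : 𝒳 → Eucl (n + 1) → F}
    (h : M.EqRadonInvDeriv (fun ω => k (M.Y ω, M.D ω)) T)
    (h' : M'.EqRadonInvDeriv (fun ω => k (M'.Y ω, M'.D ω)) T') :
    ∀ᵐ x ∂M.lawX, T' x =ᵐ[volume] T x := by
  have hX : M'.lawX = M.lawX :=
    map_observables_eq hlaw (r := fun o => o.2.2.2.2) (by fun_prop)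
  have hSVX : M'.P.map (fun ω => (M'.X ω, (M'.St ω, M'.Vt ω)))
      = M.P.map (fun ω => (M.X ω, (M.St ω, M.Vt ω))) :=
    map_observables_eq hlaw (r := fun o => (o.2.2.2.2, normalize (o.2.2.1, o.2.2.2.1)))
      ((by fun_prop : Measurable fun o : ℝ × ℝ × ℝ × Eucl n × 𝒳 => o.2.2.2.2).prodMk
        (measurable_normalize.comp (by fun_prop)))
  have hsupp : M'.suppSV = M.suppSV := by
    unfold suppSV
    rw [condDistrib_eq_of_map_eq hSVX]
  have hr : Measurable fun o : ℝ × ℝ × ℝ × Eucl n × 𝒳 =>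
      (((normalize (o.2.2.1, o.2.2.2.1)).1, (normalize (o.2.2.1, o.2.2.2.1)).2, o.2.2.2.2) :
        Eucl (n + 1) × ℝ × 𝒳) := by
    have h0 : Measurable fun o : ℝ × ℝ × ℝ × Eucl n × 𝒳 => normalize (o.2.2.1, o.2.2.2.1) :=
      measurable_normalize.comp (by fun_prop)
    exact h0.fst.prodMk (h0.snd.prodMk (by fun_prop))
  have hT : M'.P.map (fun ω => (M'.St ω, M'.Vt ω, M'.X ω))
      = M.P.map (fun ω => (M.St ω, M.Vt ω, M.X ω)) := map_observables_eq hlaw hr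
  have hTY : M'.P.map (fun ω => ((M'.St ω, M'.Vt ω, M'.X ω), (M'.Y ω, M'.D ω)))
      = M.P.map (fun ω => ((M.St ω, M.Vt ω, M.X ω), (M.Y ω, M.D ω))) :=
    map_observables_eq hlaw (hr.prodMk (by fun_prop :
      Measurable fun o : ℝ × ℝ × ℝ × Eucl n × 𝒳 => (o.1, o.2.1)))
  have hi' : Integrable (fun ω => k (M'.Y ω, M'.D ω)) M'.P := by
    have hmap : M'.P.map (fun ω => (M'.Y ω, M'.D ω)) = M.P.map (fun ω => (M.Y ω, M.D ω)) :=
      map_observables_eq hlaw (r := fun o => (o.1, o.2.1)) (by fun_prop)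
    have h1 : Integrable k (M.P.map (fun ω => (M.Y ω, M.D ω))) :=
      (integrable_map_measure hk.aestronglyMeasurable (by fun_prop)).2 hi
    rw [← hmap] at h1
    exact (integrable_map_measure hk.aestronglyMeasurable (by fun_prop)).1 h1
  obtain ⟨m, hm⟩ := h.1
  have hm' : M'.IsRegression (fun ω => k (M'.Y ω, M'.D ω)) m := by
    refine ⟨hm.stronglyMeasurable, ?_, ?_⟩
    · have e := condExp_ae_eq_integral_condDistrib (μ := M.P)
        (X := fun ω => (M.St ω, M.Vt ω, M.X ω)) (Y := fun ω => (M.Y ω, M.D ω)) (by fun_prop)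
        (by fun_prop) hk hi
      have e' := condExp_ae_eq_integral_condDistrib (μ := M'.P)
        (X := fun ω => (M'.St ω, M'.Vt ω, M'.X ω)) (Y := fun ω => (M'.Y ω, M'.D ω)) (by fun_prop)
        (by fun_prop) hk hi'
      refine EventuallyEq.trans ?_ e'.symm
      rw [condDistrib_eq_of_map_eq hTY]
      have e1 := hm.condExp_eq.trans e
      have hms : MeasurableSet {t : Eucl (n + 1) × ℝ × 𝒳 | m t =
          ∫ y, k y ∂condDistrib (fun ω => (M.Y ω, M.D ω)) (fun ω => (M.St ω, M.Vt ω, M.X ω)) M.P t} :=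
        StronglyMeasurable.measurableSet_eq_fun hm.stronglyMeasurable
          ((hk.comp_measurable measurable_snd).integral_condDistrib)
      have e2 := (ae_map_iff (by fun_prop) hms).2 e1
      rw [← hT] at e2
      exact (ae_map_iff (by fun_prop) hms).1 e2
    · rw [hX, hsupp]; exact hm.continuousOn
  have h2 := h'.2 m hm'
  rw [hX, hsupp] at h2
  filter_upwards [h.2 m hm, h2] with x hx hx'
  exact hx'.2.trans hx.2.symm

end Identification

section InversionFormulas

variable {𝕜 : Type*} [RCLike 𝕜]

/-- The three inversion formulas: treated outcomes are `Y₁`, untreated ones are `Y₀`, and `φ = 1`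
yields the density of the coefficients. -/
theorem eqRadonInvDeriv (hM : M.InstrumentAssumption) (hS : M.LargeSupport) {φ : ℝ → 𝕜}
    (hφ : StronglyMeasurable φ) (hφ₀ : Integrable (fun ω => φ (M.Y₀ ω)) M.P)
    (hφ₁ : Integrable (fun ω => φ (M.Y₁ ω)) M.P) :
    M.EqRadonInvDeriv M.D M.condDensity ∧
      M.EqRadonInvDeriv (fun ω => M.D ω • φ (M.Y ω)) (M.condMeanDensity M.Y₁ φ) ∧
      M.EqRadonInvDeriv (fun ω => (M.D ω - 1) • φ (M.Y ω)) (M.condMeanDensity M.Y₀ φ) := by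
  refine ⟨?_, ?_, ?_⟩
  · have h := eqRadonInvDeriv_sub_smul hM hS M.measurable_Y₁ hM.indep₁
      (φ := fun _ => (1 : ℝ)) stronglyMeasurable_const (integrable_const 1) 0
    simp only [sub_zero, smul_eq_mul, mul_one] at h
    refine h.congr fun x => ?_
    filter_upwards [M.ae_condDensity_eq_zero x] with γ hγ
    by_cases hs : γ ∈ M.suppΓt x
    · simp [condMeanDensity, hs]
    · simp [condMeanDensity, hγ hs]
  · simp only [D_smul_comp_Y]
    exact eqRadonInvDeriv_sub_smul hM hS M.measurable_Y₁ hM.indep₁ hφ hφ₁ 0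
  · simp only [D_sub_one_smul_comp_Y]
    exact eqRadonInvDeriv_sub_smul hM hS M.measurable_Y₀ hM.indep₀ hφ hφ₀ 1

end InversionFormulas

end SelectionModel

theorem theorem1 {n : ℕ} (hL : 2 ≤ n + 1) {Ω 𝒳 𝕜 : Type*} [MeasurableSpace Ω]
    [MeasurableSpace 𝒳] [RCLike 𝕜] (M : SelectionModel n Ω 𝒳)
    (hM : M.InstrumentAssumption) (hS : M.LargeSupport)
    (φ : ℝ → 𝕜) (hφ : StronglyMeasurable φ)
    (hφ₀ : Integrable (fun ω => φ (M.Y₀ ω)) M.P)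
    (hφ₁ : Integrable (fun ω => φ (M.Y₁ ω)) M.P) :
    -- the three inversion formulas
    (M.EqRadonInvDeriv M.D M.condDensity ∧
      M.EqRadonInvDeriv (fun ω => M.D ω • φ (M.Y ω)) (M.condMeanDensity M.Y₁ φ) ∧
      M.EqRadonInvDeriv (fun ω => (M.D ω - 1) • φ (M.Y ω)) (M.condMeanDensity M.Y₀ φ)) ∧
    -- identification: the law of the observables determines the three functions
    (∀ {Ω' : Type*} [MeasurableSpace Ω'] (M' : SelectionModel n Ω' 𝒳),
      M'.InstrumentAssumption → M'.LargeSupport →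
      Integrable (fun ω => φ (M'.Y₀ ω)) M'.P → Integrable (fun ω => φ (M'.Y₁ ω)) M'.P →
      M'.observedLaw = M.observedLaw →
      ∀ᵐ x ∂M.lawX, M'.condDensity x =ᵐ[volume] M.condDensity x ∧
        M'.condMeanDensity M'.Y₁ φ x =ᵐ[volume] M.condMeanDensity M.Y₁ φ x ∧
        M'.condMeanDensity M'.Y₀ φ x =ᵐ[volume] M.condMeanDensity M.Y₀ φ x) := by
  obtain ⟨hD, h₁, h₀⟩ := SelectionModel.eqRadonInvDeriv hM hS hφ hφ₀ hφ₁
  refine ⟨⟨hD, h₁, h₀⟩, fun M' hM' hS' hφ₀' hφ₁' hlaw => ?_⟩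
  obtain ⟨hD', h₁', h₀'⟩ := SelectionModel.eqRadonInvDeriv hM' hS' hφ hφ₀' hφ₁'
  have hiD : Integrable M.D M.P := by
    simpa using SelectionModel.integrable_sub_smul (M := M) (U := M.Y₁) (φ := fun _ => (1 : ℝ))
      (integrable_const 1) 0
  have hi₁ : Integrable (fun ω => M.D ω • φ (M.Y ω)) M.P := by
    simp only [SelectionModel.D_smul_comp_Y]
    exact SelectionModel.integrable_sub_smul hφ₁ 0
  have hi₀ : Integrable (fun ω => (M.D ω - 1) • φ (M.Y ω)) M.P := by
    simp only [SelectionModel.D_sub_one_smul_comp_Y]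
    exact SelectionModel.integrable_sub_smul hφ₀ 1
  have hφm : StronglyMeasurable fun p : ℝ × ℝ => φ p.1 := hφ.comp_measurable measurable_fst
  filter_upwards [hD.identified hlaw (k := fun p => p.2) measurable_snd.stronglyMeasurable hiD hD',
    h₁.identified hlaw (k := fun p => p.2 • φ p.1)
      (measurable_snd.stronglyMeasurable.smul hφm) hi₁ h₁',
    h₀.identified hlaw (k := fun p => (p.2 - 1) • φ p.1)
      ((measurable_snd.sub_const 1).stronglyMeasurable.smul hφm) hi₀ h₀'] with x hx hx₁ hx₀
  exact ⟨hx, hx₁, hx₀⟩
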